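/- **Conventions.** Let $X$ be a set with at least four points. A tuple in $X$ is admissible if each point occurs at most twice in it; $\mathcal A_n$ is the set of admissible $n$-tuples. Put $L_4=\{(x,y,z)\in\mathbb R^3: x+y+z=0\}$ and $\overline{L_4}=L_4\cup\{(0,\infty,-\infty),(-\infty,0,\infty),(\infty,-\infty,0)\}$. A generalized Möbius structure on $X$ is a map $M=(a,b,c):\mathcal A_4\to\overline{L_4}$ such that (1) $M(\pi P)=\mathrm{sgn}(\pi)\varphi(\pi)M(P)$ for all $\pi\in\mathcal S_4$, where $\varphi:\mathcal S_4\to\mathcal S_3$ is the action on the three pairs of opposite edges $(12)(34),(13)(42),(14)(23)$; (2) $M(P)\in L_4$ iff the entries of $P$ are pairwise distinct; (3) $M(x,x,y,z)=(0,\infty,-\infty)$; (4) for every $(x,y,\omega,\alpha,\beta)\in\mathcal A_5$ with $\omega,\alpha,\beta$ pairwise distinct and $x,y\notin\{\alpha,\beta\}$ there is $\lambda\in\mathbb R\cup\{\pm\infty\}$ with $M(\alpha x\omega\beta)+M(\alpha\omega y\beta)-M(\alpha xy\beta)=(\lambda,-\lambda,0)$. The cross-ratio triple $crt$ is $M$ composed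 with the inverse of the bijection $(p:q:r)\mapsto(\log\frac qr,\log\frac rp,\log\frac pq)$ from $$\overline\Delta=\{(p:q:r): p,q,r>0\}\cup\{(0:1:1),(1:0:1),(1:1:0)\}\subset\mathbb{R}P^2$$ onto $\overline{L_4}$. For pairwise distinct $\omega,\alpha,\beta$ put $d_{(\omega,\alpha,\beta)}(x,x)=0$ and, for $x\ne y$, $d_{(\omega,\alpha,\beta)}(x,y)=e^{a(\alpha x\omega\beta)+a(\alpha\omega y\beta)-a(\alpha xy\beta)}$ if $x\neq\beta,\ y\ne\alpha$, and $=e^{b(\alpha xy\beta)-b(\alpha x\omega\beta)-b(\alpha\omega y\beta)}$ if $x\ne\alpha,\ y\neq\beta$. The balls $\{x: d_{(\omega,\alpha,\beta)}(x,y)<r\}$ with $y\ne\omega$, $r>0$ form a subbasis of the Möbius topology. The pair $y\neq z$ is good for a sequence $(x_n)$ if, for neither $p=y$ nor $p=z$, one has $d_{(\omega,\alpha,\beta)}(x_n,p)\to0$ for all pairwise distinct $\omega,\alpha,\beta$ with $\omega\ne p$. The sequence is Cauchy if $c(x_n,x_m,y,z)\to-\infty$ as $n,m\to\infty$ for some good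 pair $y,z$. The space is complete if every Cauchy sequence converges in the Möbius topology. Cauchy sequences satisfy $(x_n)\sim(x_n')$ if $c(x_n,x_n',y,z)\to-\infty$ for every pair $y,z$ that is good for both. A Möbius equivalence is a bijection that preserves $M$ on admissible quadruples, and a Möbius embedding is an injection that does so. **Theorem.** Let $(X,crt)$ be a generalized Möbius space that satisfies the symmetry condition $\overline{\mathrm{Im}(crt)}\subseteq\overline\Delta$ (closure in $\mathbb RP^2$). Then $\sim$ is an equivalence relation on the set of Cauchy sequences of $X$, and on the quotient $\overline X$ the limits $$\overline{crt}([w_n],[x_n],[y_n],[z_n])=\lim_{n\to\infty}crt(w_n,x_n,y_n,z_n)$$ exist for admissible quadruples of classes, do not depend on the representatives, and define a generalized Möbius structure, which again satisfies the symmetry condition. The space $(\overline X,\overline{crt})$ is complete, and the canonical map $i_X:X\to\overline X$, which sends $x$ to the class of the constant sequence, is a Möbius embedding with dense image. Furthermore, if $(Y,crt')$ is a complete generalized Möbius space and $i:X\to Y$ is a Möbius embedding with dense image, then there is a unique Möbius equivalence $f:\overline X\to Y$ with $i=f\circ i_X$. -/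

import Mathlib

open Filter Topology
open scoped ENNReal LinearAlgebra.Projectivization

/-- The real projective plane. -/
abbrev RP2 : Type := ℙ ℝ (Fin 3 → ℝ)

/-- The usual topology of the real projective plane: the quotient topology from `ℝ³ ∖ {0}`. -/
noncomputable instance instTopologicalSpaceRP2 : TopologicalSpace RP2 :=
  TopologicalSpace.coinduced (Projectivization.mk' ℝ (V := Fin 3 → ℝ)) inferInstance

namespace GenMobius

universe u v

/-- An `n`-tuple is admissible if every point appears at most twice in it. -/
def Admissible {X : Type u} {n : ℕ} (P : Fin n → X) : Prop :=
  ∀ i j k : Fin n, P i = P j → P j = P k → i = j ∨ j = k ∨ i = k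

/-! ### The spaces of values -/

/-- The plane `L₄ = {(x, y, z) ∈ ℝ³ | x + y + z = 0}`, inside the triples of extended reals. -/
def L4 : Set (Fin 3 → EReal) :=
  {v | ∃ x y z : ℝ, x + y + z = 0 ∧ v = ![(x : EReal), (y : EReal), (z : EReal)]}

/-- `L₄` together with its three points at infinity. -/
def L4bar : Set (Fin 3 → EReal) :=
  L4 ∪ {![0, ⊤, ⊥], ![⊥, 0, ⊤], ![⊤, ⊥, 0]}

/-- The point `(a : b : c)` of the projective plane, for `(a, b, c) ≠ 0`. -/
noncomputable def pt (a b c : ℝ) (h : (![a, b, c] : Fin 3 → ℝ) ≠ 0) : RP2 :=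
  Projectivization.mk ℝ ![a, b, c] h

/-- `Δ = {(a : b : c) | a, b, c > 0}`. -/
def Delta : Set RP2 :=
  {p | ∃ a b c : ℝ, ∃ h, 0 < a ∧ 0 < b ∧ 0 < c ∧ p = pt a b c h}

/-- The point `(0 : 1 : 1)`. -/
noncomputable def pt011 : RP2 := pt 0 1 1 (fun h => one_ne_zero (congrFun h 1))

/-- The point `(1 : 0 : 1)`. -/
noncomputable def pt101 : RP2 := pt 1 0 1 (fun h => one_ne_zero (congrFun h 0))

/-- The point `(1 : 1 : 0)`. -/
noncomputable def pt110 : RP2 := pt 1 1 0 (fun h => one_ne_zero (congrFun h 0))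

/-- `Δ` together with `(0 : 1 : 1)`, `(1 : 0 : 1)`, `(1 : 1 : 0)`. -/
def Deltabar : Set RP2 := Delta ∪ {pt011, pt101, pt110}

open Classical in
/-- The identification of `L4bar` with `Deltabar`, inverse to
`(a : b : c) ↦ (log (b / c), log (c / a), log (a / b))`. A point `(x, y, z)` of `L₄` goes to
`(γ^{1/3} β^{-1/3} : α^{1/3} γ^{-1/3} : β^{1/3} α^{-1/3})` where
`(α, β, γ) = (e^x, e^y, e^z)`; only the values on `L4bar` matter. -/
noncomputable def toRP2 (v : Fin 3 → EReal) : RP2 :=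
  if v = ![0, ⊤, ⊥] then pt011
  else if v = ![⊥, 0, ⊤] then pt101
  else if v = ![⊤, ⊥, 0] then pt110
  else pt (Real.exp (((v 2).toReal - (v 1).toReal) / 3))
    (Real.exp (((v 0).toReal - (v 2).toReal) / 3))
    (Real.exp (((v 1).toReal - (v 0).toReal) / 3))
    (fun h => Real.exp_ne_zero _ (congrFun h 0))

/-! ### The homomorphism `S₄ → S₃` -/

/-- The three pairs of opposite edges of the tetrahedron with vertices `0, 1, 2, 3` are
`(01)(23)`, `(02)(31)`, `(03)(12)`, in this order. For `i ≠ j`, this is the position in that list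
of the pair that contains the edge `(ij)`; the diagonal entries are irrelevant. -/
def edgePair : Fin 4 → Fin 4 → Fin 3 :=
  ![![0, 0, 1, 2], ![0, 0, 2, 1], ![1, 2, 0, 0], ![2, 1, 0, 0]]

/-- The permutation of the three pairs of opposite edges induced by a permutation of the vertices:
the `j`-th pair is the one that contains the edge between `0` and `j + 1`. -/
def phi (π : Equiv.Perm (Fin 4)) (j : Fin 3) : Fin 3 := edgePair (π 0) (π j.succ)

/-- The action of `sgn π` on an extended real. -/
noncomputable def sgnSmul (π : Equiv.Perm (Fin 4)) (t : EReal) : EReal :=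
  if Equiv.Perm.sign π = 1 then t else -t

end GenMobius

open GenMobius

/-- A generalized Möbius structure on `X`, a set with at least four points. The map `M` is defined
on admissible quadruples; to have a total function it is given the value `0` on the others
(`map_of_not_admissible`), which carries no information.

The sums in `cocycle` never involve `∞ - ∞`: by `perm`, `nondeg` and `degen` a sum of that kind
could only come from `x = y = ω`, which is not admissible. In the same way, for pairwise distinct
`α, ω, β`, the first component of `M(αxωβ) + M(αωyβ) - M(αxyβ)` is well defined as soon as `x ≠ β`
and `y ≠ α`, and the second one as soon as `x ≠ α` and `y ≠ β`. -/
structure GenMobiusStructure (X : Type*) where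
  M : (Fin 4 → X) → Fin 3 → EReal
  four_points : ∃ P : Fin 4 → X, Function.Injective P
  map_mem : ∀ P, Admissible P → M P ∈ L4bar
  map_of_not_admissible : ∀ P, ¬ Admissible P → M P = 0
  perm : ∀ P, Admissible P → ∀ (π : Equiv.Perm (Fin 4)) (j : Fin 3),
    M (P ∘ π) j = sgnSmul π (M P (phi π j))
  nondeg : ∀ P, Admissible P → (M P ∈ L4 ↔ Function.Injective P)
  degen : ∀ x y z : X, Admissible ![x, x, y, z] → M ![x, x, y, z] = ![0, ⊤, ⊥]
  cocycle : ∀ x y ω α β : X, Admissible ![x, y, ω, α, β] →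
    α ≠ ω → ω ≠ β → β ≠ α → α ≠ x → x ≠ β → α ≠ y → y ≠ β →
    ∃ l : EReal, M ![α, x, ω, β] + M ![α, ω, y, β] - M ![α, x, y, β] = ![l, -l, 0]

namespace GenMobiusStructure

universe u v

variable {X : Type u} {Y : Type v}

/-- The cross-ratio triple in the real projective plane. -/
noncomputable def crt (S : GenMobiusStructure X) (P : Fin 4 → X) : RP2 := toRP2 (S.M P)

open Classical in
/-- The semi-metric `d_A` for a non-degenerate triple `A = (ω, α, β)`, where `M = (a, b, c)`:
`d_A(x, y) = exp (a(αxωβ) + a(αωyβ) - a(αxyβ))` if `x ≠ β` and `y ≠ α`, and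
`d_A(x, y) = exp (b(αxyβ) - b(αxωβ) - b(αωyβ))` if `x ≠ α` and `y ≠ β`
(the two agree if both apply), and `d_A(x, x) = 0`. -/
noncomputable def dA (S : GenMobiusStructure X) (ω α β x y : X) : ℝ≥0∞ :=
  if x = y then 0
  else if x ≠ β ∧ y ≠ α then
    EReal.exp (S.M ![α, x, ω, β] 0 + S.M ![α, ω, y, β] 0 - S.M ![α, x, y, β] 0)
  else
    EReal.exp (S.M ![α, x, y, β] 1 - S.M ![α, x, ω, β] 1 - S.M ![α, ω, y, β] 1)

/-- The Möbius topology: all open balls with respect to all `d_A`, around points that are not at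
infinity for `d_A`, form a subbasis. -/
@[reducible]
def topology (S : GenMobiusStructure X) : TopologicalSpace X :=
  TopologicalSpace.generateFrom
    {B | ∃ ω α β y : X, ∃ r : ℝ, ω ≠ α ∧ α ≠ β ∧ ω ≠ β ∧ y ≠ ω ∧ 0 < r ∧
      B = {x | S.dA ω α β x y < ENNReal.ofReal r}}

/-- The (symmetry)-condition: the closure of the image of `crt` in the projective plane is
contained in `Deltabar`. -/
def SymmetryCondition (S : GenMobiusStructure X) : Prop :=
  closure (S.crt '' {P | Admissible P}) ⊆ Deltabar

/-- `d_A(xₙ, p) → 0` for all `d_A` that do not have `p` at infinity. (Under the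
(corner)-condition, all these `d_A` are quasi-metrics related by involutions, and one of them
suffices.) -/
def ConvergesTo (S : GenMobiusStructure X) (x : ℕ → X) (p : X) : Prop :=
  ∀ ω α β : X, ω ≠ α → α ≠ β → ω ≠ β → ω ≠ p →
    Tendsto (fun n => S.dA ω α β (x n) p) atTop (𝓝 0)

/-- Good pairs for a sequence. -/
def GoodPair (S : GenMobiusStructure X) (x : ℕ → X) (y z : X) : Prop :=
  y ≠ z ∧ ¬ S.ConvergesTo x y ∧ ¬ S.ConvergesTo x z

/-- Cauchy sequences: for one good pair `y, z` we have `c(xₙ, xₘ, y, z) → -∞` as `n, m → ∞`,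
where `M = (a, b, c)`. -/
def IsCauchy (S : GenMobiusStructure X) (x : ℕ → X) : Prop :=
  ∃ y z : X, S.GoodPair x y z ∧
    Tendsto (fun nm : ℕ × ℕ => S.M ![x nm.1, x nm.2, y, z] 2) (atTop ×ˢ atTop) (𝓝 ⊥)

/-- Every Cauchy sequence converges in the Möbius topology. -/
def IsComplete (S : GenMobiusStructure X) : Prop :=
  ∀ x : ℕ → X, S.IsCauchy x → ∃ p : X, Tendsto x atTop (@nhds X S.topology p)

/-- `f` preserves the generalized Möbius structures. -/
def Preserves (S : GenMobiusStructure X) (T : GenMobiusStructure Y) (f : X → Y) : Prop :=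
  ∀ P : Fin 4 → X, Admissible P → T.M (f ∘ P) = S.M P

/-- Möbius equivalences. -/
def IsMobiusEquiv (S : GenMobiusStructure X) (T : GenMobiusStructure Y) (f : X → Y) : Prop :=
  Function.Bijective f ∧ S.Preserves T f

/-- Möbius embeddings: injective maps that are Möbius equivalences onto their image. -/
def IsMobiusEmbedding (S : GenMobiusStructure X) (T : GenMobiusStructure Y) (f : X → Y) : Prop :=
  Function.Injective f ∧ S.Preserves T f

/-- The set of Cauchy sequences. -/
def CauchySequences (S : GenMobiusStructure X) : Type u := {x : ℕ → X // S.IsCauchy x}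

/-- `(xₙ) ∼ (x'ₙ)` iff `c(xₙ, x'ₙ, y, z) → -∞` for every pair `y, z` that is good for both. -/
def Equivalent (S : GenMobiusStructure X) (x x' : S.CauchySequences) : Prop :=
  ∀ y z : X, S.GoodPair x.1 y z → S.GoodPair x'.1 y z →
    Tendsto (fun n => S.M ![x.1 n, x'.1 n, y, z] 2) atTop (𝓝 ⊥)

/-- The set of Cauchy sequences modulo `∼`. -/
def Completion (S : GenMobiusStructure X) : Type u := Quot S.Equivalent

/-- The class of a Cauchy sequence. -/
def toCompletion (S : GenMobiusStructure X) (x : S.CauchySequences) : S.Completion :=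
  Quot.mk _ x

/-- `T` is the limit structure on the completion: for all Cauchy sequences `w, x, y, z`, the value
of its cross-ratio triple at the classes of `w, x, y, z` is the limit of `crt(wₙ, xₙ, yₙ, zₙ)`. -/
def IsLimitStructure (S : GenMobiusStructure X) (T : GenMobiusStructure S.Completion) : Prop :=
  ∀ ξ : Fin 4 → S.CauchySequences, Admissible (fun i => S.toCompletion (ξ i)) →
    Tendsto (fun n => S.crt (fun i => (ξ i).1 n)) atTop
      (𝓝 (T.crt (fun i => S.toCompletion (ξ i))))

/-! ### Constant sequences are Cauchy -/

theorem exists_three_ne (S : GenMobiusStructure X) (x : X) :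
    ∃ ω y z : X, ω ≠ x ∧ y ≠ x ∧ z ≠ x ∧ ω ≠ y ∧ y ≠ z ∧ ω ≠ z := by
  obtain ⟨P, hP⟩ := S.four_points
  have h : ∀ i j : Fin 4, i ≠ j → P i ≠ P j := fun i j hij => hP.ne hij
  by_cases h0 : P 0 = x
  · subst h0
    exact ⟨P 1, P 2, P 3, h _ _ (by decide), h _ _ (by decide), h _ _ (by decide),
      h _ _ (by decide), h _ _ (by decide), h _ _ (by decide)⟩
  by_cases h1 : P 1 = x
  · subst h1
    exact ⟨P 0, P 2, P 3, h _ _ (by decide), h _ _ (by decide), h _ _ (by decide),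
      h _ _ (by decide), h _ _ (by decide), h _ _ (by decide)⟩
  by_cases h2 : P 2 = x
  · subst h2
    exact ⟨P 0, P 1, P 3, h _ _ (by decide), h _ _ (by decide), h _ _ (by decide),
      h _ _ (by decide), h _ _ (by decide), h _ _ (by decide)⟩
  exact ⟨P 0, P 1, P 2, h0, h1, h2, h _ _ (by decide), h _ _ (by decide), h _ _ (by decide)⟩

theorem map_pair_one (S : GenMobiusStructure X) {x y z : X} (hxy : x ≠ y) (hyz : y ≠ z) :
    S.M ![y, x, y, z] 1 = 0 := by
  have hadm : Admissible ![y, y, x, z] := by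
    intro i j k
    fin_cases i <;> fin_cases j <;> fin_cases k <;> simp_all [eq_comm]
  have h := S.perm _ hadm (Equiv.swap 1 2) 1
  have hP : (![y, y, x, z] ∘ (Equiv.swap 1 2 : Equiv.Perm (Fin 4))) = ![y, x, y, z] := by
    funext i
    fin_cases i <;> rfl
  have hphi : phi (Equiv.swap 1 2) 1 = 0 := by decide
  rw [hP, hphi, S.degen _ _ _ hadm] at h
  simpa [sgnSmul] using h

theorem not_convergesTo_const (S : GenMobiusStructure X) {x y z ω : X} (hωx : ω ≠ x) (hyx : y ≠ x)
    (hzx : z ≠ x) (hωy : ω ≠ y) (hyz : y ≠ z) (hωz : ω ≠ z) :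
    ¬ S.ConvergesTo (fun _ => x) y := by
  intro h
  have h0 := tendsto_nhds_unique tendsto_const_nhds (h ω y z hωy hyz hωz hωy)
  have hinj : Function.Injective ![y, x, ω, z] := by
    intro i j
    fin_cases i <;> fin_cases j <;> simp_all [eq_comm]
  have hadm : Admissible ![y, x, ω, z] := fun i j k hij _ => Or.inl (hinj hij)
  obtain ⟨a, b, c, -, hM⟩ := (S.nondeg _ hadm).2 hinj
  have hb : S.M ![y, x, ω, z] 1 = (b : EReal) := by rw [hM]; rfl
  rw [dA, if_neg hyx.symm, if_neg (by simp), map_pair_one S hyx.symm hyz,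
    map_pair_one S hωy hyz, hb, EReal.exp_eq_zero_iff] at h0
  rw [sub_zero, zero_sub, ← EReal.coe_neg] at h0
  exact EReal.coe_ne_bot _ h0

theorem isCauchy_const (S : GenMobiusStructure X) (x : X) : S.IsCauchy (fun _ => x) := by
  obtain ⟨ω, y, z, h1, h2, h3, h4, h5, h6⟩ := S.exists_three_ne x
  refine ⟨y, z, ⟨h5, S.not_convergesTo_const h1 h2 h3 h4 h5 h6,
    S.not_convergesTo_const h1 h3 h2 h6 h5.symm h4⟩, ?_⟩
  have hadm : Admissible ![x, x, y, z] := by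
    intro i j k
    fin_cases i <;> fin_cases j <;> fin_cases k <;> simp_all [eq_comm]
  simp only [S.degen _ _ _ hadm]
  exact tendsto_const_nhds

/-- The canonical inclusion, given by constant sequences. -/
def incl (S : GenMobiusStructure X) (x : X) : S.Completion :=
  S.toCompletion ⟨fun _ => x, S.isCauchy_const x⟩

end GenMobiusStructure

/-! Every generalized Möbius structure is induced by a semimetric `ρ`, a gauge: `M(P)` consists of
the logarithms of the ratios of the three products of opposite edge lengths of `P`. To find `ρ`,
send a point `ω` to infinity; the third component of axiom (4) makes `c(x, y, z, ω)` a difference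
`log ρ(x, y) - log ρ(x, z)`, and symmetry of `ρ` follows from `a + b + c = 0` (`exists_isGauge`).
Replacing `ρ(x, y)` by `λ(x) λ(y) ρ(x, y)` changes no cross-ratio, so one may normalize `ρ(x, u) +
ρ(x, v) = 1`, which leaves no point at infinity.

In a gauge, `crt(P)` has the three edge products as homogeneous coordinates. By compactness the
symmetry condition becomes uniform (`IsGauge.isBalanced`): if one product is small compared with the
others, those two are nearly equal. For the normalized gauge this yields a Ptolemy inequality, hence
a bounded quasi-metric (`exists_bound`), and uniform continuity of `ρ` in each variable
(`uniform_continuity`). Möbius convergence, Cauchy sequences and `∼` then agree with the notions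
defined by `ρ`, and the classical completion works: `ρ` passes to limits, remains a semimetric, and
induces the structure on the quotient.

For the universal property, the symmetry condition is not assumed on `Y`. A gauge of `Y` inherits
the balance condition from the dense image (`IsGauge.isBalanced_of_dense`), after which `i` extends
by limits. The gauges of `X` and `Y` need not match, but their edge products have the same ratios,
so the extension preserves `M`. -/

namespace GenMobius

universe u v

variable {X : Type u} {Y : Type v}

/-! ### Semimetrics and the cross-ratio triples they induce -/

theorem Admissible.of_injective {n : ℕ} {P : Fin n → X} (h : Function.Injective P) :
    Admissible P := fun _ _ _ hij _ => Or.inl (h hij)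

theorem Admissible.comp_perm {n : ℕ} {P : Fin n → X} (h : Admissible P)
    (π : Equiv.Perm (Fin n)) : Admissible (P ∘ π) := by
  intro i j k hij hjk
  have := h (π i) (π j) (π k) hij hjk
  simpa using this

theorem Admissible.comp {n : ℕ} {P : Fin n → X} (h : Admissible P) {f : X → Y}
    (hf : Function.Injective f) : Admissible (f ∘ P) :=
  fun i j k hij hjk => h i j k (hf hij) (hf hjk)

/-- The logarithm of the quotient `s / t`, for `s, t ≥ 0` that do not both vanish. -/
noncomputable def ratioLog (s t : ℝ) : EReal :=
  ENNReal.log (ENNReal.ofReal s / ENNReal.ofReal t)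

theorem ratioLog_of_pos {s t : ℝ} (hs : 0 < s) (ht : 0 < t) :
    ratioLog s t = ((Real.log s - Real.log t : ℝ) : EReal) := by
  rw [ratioLog, ← ENNReal.ofReal_div_of_pos ht, ENNReal.log_ofReal_of_pos (div_pos hs ht),
    Real.log_div hs.ne' ht.ne']

theorem ratioLog_self {s : ℝ} (hs : 0 < s) : ratioLog s s = 0 := by
  rw [ratioLog_of_pos hs hs, sub_self, EReal.coe_zero]

@[simp] theorem ratioLog_zero_left (t : ℝ) : ratioLog 0 t = ⊥ := by
  simp [ratioLog]

theorem ratioLog_zero_right {s : ℝ} (hs : 0 < s) : ratioLog s 0 = ⊤ := by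
  simp [ratioLog, ENNReal.div_zero, hs]

theorem exp_ratioLog (s t : ℝ) :
    EReal.exp (ratioLog s t) = ENNReal.ofReal s / ENNReal.ofReal t := by
  simp [ratioLog]

theorem neg_ratioLog {s t : ℝ} (h : 0 < s ∨ 0 < t) : -ratioLog s t = ratioLog t s := by
  rw [ratioLog, ratioLog, ← ENNReal.log_inv, ENNReal.inv_div (by simp)]
  simpa using h.symm

/-- With `ratioLog_inj`, this trades equality of logarithmic ratios for a cross-multiplied
polynomial identity, which still makes sense when a term vanishes and passes to limits. -/
theorem ratioLog_congr {s t s' t' : ℝ} (ht : 0 ≤ t) (ht' : 0 ≤ t')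
    (h : 0 < s ∨ 0 < t) (h' : 0 < s' ∨ 0 < t') (e : s * t' = s' * t) :
    ratioLog s t = ratioLog s' t' := by
  rcases ht.eq_or_lt with rfl | ht
  · have h0 : 0 < s := by simpa using h
    have : t' = 0 := by simpa [h0.ne'] using e
    subst this
    have h0' : 0 < s' := by simpa using h'
    rw [ratioLog_zero_right h0, ratioLog_zero_right h0']
  · rcases ht'.eq_or_lt with rfl | ht'
    · have : s' = 0 := by simpa [ht.ne', eq_comm] using e
      simp [this] at h'
    · rw [ratioLog, ratioLog, ← ENNReal.ofReal_div_of_pos ht, ← ENNReal.ofReal_div_of_pos ht',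
        (div_eq_div_iff ht.ne' ht'.ne').2 e]

theorem ratioLog_inj {s t s' t' : ℝ} (hs : 0 ≤ s) (ht : 0 ≤ t) (hs' : 0 ≤ s') (ht' : 0 ≤ t')
    (h : 0 < s ∨ 0 < t) (h' : 0 < s' ∨ 0 < t') (e : ratioLog s t = ratioLog s' t') :
    s * t' = s' * t := by
  have e := ENNReal.log_injective e
  rcases ht.eq_or_lt with rfl | ht
  · have h0 : 0 < s := by simpa using h
    rw [ENNReal.ofReal_zero, ENNReal.div_zero (by simpa using h0), eq_comm,
      ENNReal.div_eq_top] at e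
    rcases e with ⟨-, e⟩ | ⟨e, -⟩
    · simp [le_antisymm (by simpa using e) ht']
    · simp at e
  · rcases ht'.eq_or_lt with rfl | ht'
    · have h0 : 0 < s' := by simpa using h'
      rw [ENNReal.ofReal_zero, ENNReal.div_zero (by simpa using h0), ENNReal.div_eq_top] at e
      rcases e with ⟨-, e⟩ | ⟨e, -⟩
      · exact absurd ht (by simpa using e)
      · simp at e
    · rw [← ENNReal.ofReal_div_of_pos ht, ← ENNReal.ofReal_div_of_pos ht',
        ENNReal.ofReal_eq_ofReal_iff (div_nonneg hs ht.le) (div_nonneg hs' ht'.le)] at e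
      exact (div_eq_div_iff ht.ne' ht'.ne').1 e

/-- A symmetric function that is positive off the diagonal and vanishes on it. -/
structure IsSemimetric (ρ : X → X → ℝ) : Prop where
  symm : ∀ x y, ρ x y = ρ y x
  nonneg : ∀ x y, 0 ≤ ρ x y
  eq_zero_iff : ∀ x y, ρ x y = 0 ↔ x = y

theorem IsSemimetric.self {ρ : X → X → ℝ} (h : IsSemimetric ρ) (x : X) : ρ x x = 0 :=
  (h.eq_zero_iff x x).2 rfl

theorem IsSemimetric.pos {ρ : X → X → ℝ} (h : IsSemimetric ρ) {x y : X} (hxy : x ≠ y) :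
    0 < ρ x y :=
  lt_of_le_of_ne (h.nonneg x y) fun e => hxy ((h.eq_zero_iff x y).1 e.symm)

/-- The products of the lengths of opposite edges of a quadruple. -/
def edge (ρ : X → X → ℝ) (P : Fin 4 → X) : Fin 3 → ℝ :=
  ![ρ (P 0) (P 1) * ρ (P 2) (P 3), ρ (P 0) (P 2) * ρ (P 1) (P 3), ρ (P 0) (P 3) * ρ (P 1) (P 2)]

theorem edge_nonneg {ρ : X → X → ℝ} (h : IsSemimetric ρ) (P : Fin 4 → X) (j : Fin 3) :
    0 ≤ edge ρ P j := by
  fin_cases j <;> exact mul_nonneg (h.nonneg _ _) (h.nonneg _ _)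

theorem edge_pos {ρ : X → X → ℝ} (h : IsSemimetric ρ) {P : Fin 4 → X}
    (hP : Function.Injective P) (j : Fin 3) : 0 < edge ρ P j := by
  fin_cases j <;>
    exact mul_pos (h.pos (hP.ne (by decide))) (h.pos (hP.ne (by decide)))

/-- The vertices of the `j`-th pair of opposite edges. -/
def edgeVertex : Fin 3 → Fin 4 → Fin 4 :=
  ![![0, 1, 2, 3], ![0, 2, 1, 3], ![0, 3, 1, 2]]

theorem edge_apply (ρ : X → X → ℝ) (P : Fin 4 → X) (j : Fin 3) :
    edge ρ P j = ρ (P (edgeVertex j 0)) (P (edgeVertex j 1)) *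
      ρ (P (edgeVertex j 2)) (P (edgeVertex j 3)) := by
  fin_cases j <;> rfl

/-- A permutation of the vertices carries a pair of opposite edges to another such pair, possibly
exchanging the two edges or the ends of either one. This is a finite check. -/
theorem edgeVertex_perm : ∀ (π : Equiv.Perm (Fin 4)) (j : Fin 3),
    (((π (edgeVertex j 0) = edgeVertex (phi π j) 0 ∧ π (edgeVertex j 1) = edgeVertex (phi π j) 1) ∨
      (π (edgeVertex j 0) = edgeVertex (phi π j) 1 ∧ π (edgeVertex j 1) = edgeVertex (phi π j) 0)) ∧
    ((π (edgeVertex j 2) = edgeVertex (phi π j) 2 ∧ π (edgeVertex j 3) = edgeVertex (phi π j) 3) ∨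
      (π (edgeVertex j 2) = edgeVertex (phi π j) 3 ∧ π (edgeVertex j 3) = edgeVertex (phi π j) 2)))
    ∨
    (((π (edgeVertex j 0) = edgeVertex (phi π j) 2 ∧ π (edgeVertex j 1) = edgeVertex (phi π j) 3) ∨
      (π (edgeVertex j 0) = edgeVertex (phi π j) 3 ∧ π (edgeVertex j 1) = edgeVertex (phi π j) 2)) ∧
    ((π (edgeVertex j 2) = edgeVertex (phi π j) 0 ∧ π (edgeVertex j 3) = edgeVertex (phi π j) 1) ∨
      (π (edgeVertex j 2) = edgeVertex (phi π j) 1 ∧ π (edgeVertex j 3) = edgeVertex (phi π j) 0)))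
    := by
  decide

theorem edge_comp_perm {ρ : X → X → ℝ} (hs : ∀ x y, ρ x y = ρ y x) (P : Fin 4 → X)
    (π : Equiv.Perm (Fin 4)) (j : Fin 3) : edge ρ (P ∘ π) j = edge ρ P (phi π j) := by
  rw [edge_apply, edge_apply]
  simp only [Function.comp_apply]
  rcases edgeVertex_perm π j with ⟨⟨h0, h1⟩ | ⟨h0, h1⟩, ⟨h2, h3⟩ | ⟨h2, h3⟩⟩ |
    ⟨⟨h0, h1⟩ | ⟨h0, h1⟩, ⟨h2, h3⟩ | ⟨h2, h3⟩⟩ <;> rw [h0, h1, h2, h3]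
  · rw [hs (P (edgeVertex (phi π j) 2))]
  · rw [hs (P (edgeVertex (phi π j) 0))]
  · rw [hs (P (edgeVertex (phi π j) 2)), hs (P (edgeVertex (phi π j) 0))]
  · rw [mul_comm]
  · rw [hs (P (edgeVertex (phi π j) 0)), mul_comm]
  · rw [hs (P (edgeVertex (phi π j) 2)), mul_comm]
  · rw [hs (P (edgeVertex (phi π j) 2)), hs (P (edgeVertex (phi π j) 0)), mul_comm]

/-- Even permutations of the vertices rotate the three pairs of edges, odd ones reflect their cyclic
order. A reflection inverts the ratios, which accounts for the factor `sgn π`. -/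
theorem phi_add_of_sign_eq_one : ∀ (π : Equiv.Perm (Fin 4)) (j : Fin 3),
    Equiv.Perm.sign π = 1 → phi π (j + 1) = phi π j + 1 ∧ phi π (j + 2) = phi π j + 2 := by
  decide

theorem phi_add_of_sign_ne_one : ∀ (π : Equiv.Perm (Fin 4)) (j : Fin 3),
    Equiv.Perm.sign π ≠ 1 → phi π (j + 1) = phi π j + 2 ∧ phi π (j + 2) = phi π j + 1 := by
  decide

/-- Reduces degenerate quadruples to the shape of axiom (3); `y = z` remains possible. -/
theorem eq_of_coincidences {P : Fin 4 → X} (hP : Admissible P) :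
    Function.Injective P ∨ ∃ (π : Equiv.Perm (Fin 4)) (x y z : X),
      P ∘ π = ![x, x, y, z] ∧ x ≠ y ∧ x ≠ z := by
  by_cases h : Function.Injective P
  · exact Or.inl h
  · right
    obtain ⟨i, j, hij, hne⟩ : ∃ i j, P i = P j ∧ i ≠ j := by
      simpa [Function.Injective] using h
    obtain ⟨π, rfl, rfl⟩ : ∃ π : Equiv.Perm (Fin 4), π 0 = i ∧ π 1 = j := by
      revert i j
      have : ∀ i j : Fin 4, i ≠ j → ∃ π : Equiv.Perm (Fin 4), π 0 = i ∧ π 1 = j := by decide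
      exact fun i j _ h => this i j h
    refine ⟨π, P (π 0), P (π 2), P (π 3), ?_, ?_, ?_⟩
    · funext k
      fin_cases k
      · rfl
      · exact hij.symm
      · rfl
      · rfl
    · intro e
      have := hP (π 1) (π 0) (π 2) hij.symm e
      simp at this
    · intro e
      have := hP (π 1) (π 0) (π 3) hij.symm e
      simp at this

/-- For `(x, x, y, z)` only the product of index 0 vanishes, so an admissible quadruple has at most
one zero product. Hence `gaugeM` never takes the meaningless ratio `0 / 0` there. -/
theorem edge_pos_or {ρ : X → X → ℝ} (h : IsSemimetric ρ) {P : Fin 4 → X} (hP : Admissible P)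
    {i j : Fin 3} (hij : i ≠ j) : 0 < edge ρ P i ∨ 0 < edge ρ P j := by
  rcases eq_of_coincidences hP with hi | ⟨π, x, y, z, e, hy, hz⟩
  · exact Or.inl (edge_pos h hi i)
  · have key : ∀ k : Fin 3, k ≠ 0 → 0 < edge ρ (P ∘ π) k := by
      intro k hk
      rw [e]
      have := mul_pos (h.pos hy) (h.pos hz)
      fin_cases k
      · exact absurd rfl hk
      · exact this
      · exact mul_pos (h.pos hz) (h.pos hy)
    have hs : ∀ (π : Equiv.Perm (Fin 4)) (i j : Fin 3), i ≠ j →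
      ∃ k : Fin 3, k ≠ 0 ∧ (phi π k = i ∨ phi π k = j) := by decide
    obtain ⟨k, hk, hk'⟩ := hs π i j hij
    have := key k hk
    rw [edge_comp_perm h.symm] at this
    rcases hk' with hk' | hk' <;> rw [hk'] at this
    · exact Or.inl this
    · exact Or.inr this

/-- Two opposite edges partition the vertices, so among three coinciding vertices two span one of
these edges. -/
theorem edge_eq_zero_of_not_admissible {ρ : X → X → ℝ} (h : IsSemimetric ρ) {P : Fin 4 → X}
    (hP : ¬ Admissible P) (j : Fin 3) : edge ρ P j = 0 := by
  simp only [Admissible, not_forall, not_or] at hP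
  obtain ⟨a, b, c, hab, hbc, h1, h2, h3⟩ := hP
  have hc : ∀ (a b c : Fin 4) (j : Fin 3), a ≠ b → b ≠ c → a ≠ c →
      ∃ s t : Fin 4, (s = a ∨ s = b ∨ s = c) ∧ (t = a ∨ t = b ∨ t = c) ∧
      ((s = edgeVertex j 0 ∧ t = edgeVertex j 1) ∨ (s = edgeVertex j 2 ∧ t = edgeVertex j 3)) := by
    decide
  obtain ⟨s, t, hs, ht, hst⟩ := hc a b c j h1 h2 h3
  have e : P s = P t := by
    rcases hs with rfl | rfl | rfl <;> rcases ht with rfl | rfl | rfl <;> simp_all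
  have e0 : ρ (P s) (P t) = 0 := (h.eq_zero_iff _ _).2 e
  rw [edge_apply]
  rcases hst with ⟨rfl, rfl⟩ | ⟨rfl, rfl⟩ <;> simp [e0]

/-- The triple of logarithmic cross-ratios of a semimetric. -/
noncomputable def gaugeM (ρ : X → X → ℝ) (P : Fin 4 → X) (j : Fin 3) : EReal :=
  ratioLog (edge ρ P (j + 1)) (edge ρ P (j + 2))

theorem gaugeM_perm {ρ : X → X → ℝ} (h : IsSemimetric ρ) {P : Fin 4 → X} (hP : Admissible P)
    (π : Equiv.Perm (Fin 4)) (j : Fin 3) :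
    gaugeM ρ (P ∘ π) j = sgnSmul π (gaugeM ρ P (phi π j)) := by
  rw [gaugeM, gaugeM, sgnSmul, edge_comp_perm h.symm, edge_comp_perm h.symm]
  split_ifs with hπ
  · rw [(phi_add_of_sign_eq_one π j hπ).1, (phi_add_of_sign_eq_one π j hπ).2]
  · rw [(phi_add_of_sign_ne_one π j hπ).1, (phi_add_of_sign_ne_one π j hπ).2, neg_ratioLog]
    refine edge_pos_or h hP ?_
    generalize phi π j = k
    revert k
    decide

theorem gaugeM_degen {ρ : X → X → ℝ} (h : IsSemimetric ρ) {x y z : X} (hy : x ≠ y) (hz : x ≠ z) :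
    gaugeM ρ ![x, x, y, z] = ![0, ⊤, ⊥] := by
  have hp : 0 < ρ x z * ρ x y := mul_pos (h.pos hz) (h.pos hy)
  funext j
  fin_cases j
  · change ratioLog (ρ x y * ρ x z) (ρ x z * ρ x y) = 0
    rw [mul_comm]
    exact ratioLog_self hp
  · change ratioLog (ρ x z * ρ x y) (ρ x x * ρ y z) = ⊤
    rw [h.self, zero_mul, ratioLog_zero_right hp]
  · change ratioLog (ρ x x * ρ y z) (ρ x y * ρ x z) = ⊥
    rw [h.self, zero_mul, ratioLog_zero_left]

/-- Leaves room for `s = α`, `t = β` and `s = t`, coincidences that occur in the quadruples of `dA`.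
-/
theorem admissible_of_ne_ne {α β s t : X} (h : α ≠ β) (hs : s ≠ β) (ht : α ≠ t) :
    Admissible ![α, s, t, β] := by
  intro i j k hij hjk
  -- Any three distinct positions contain one of the pairs `{0, 3}`, `{1, 3}`, `{0, 2}`, whose
  -- entries differ by assumption.
  have hc : ∀ i j k : Fin 4, (i = j ∨ j = k ∨ i = k) ∨
      ((0 = i ∨ 0 = j ∨ 0 = k) ∧ (3 = i ∨ 3 = j ∨ 3 = k)) ∨
      ((1 = i ∨ 1 = j ∨ 1 = k) ∧ (3 = i ∨ 3 = j ∨ 3 = k)) ∨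
      ((0 = i ∨ 0 = j ∨ 0 = k) ∧ (2 = i ∨ 2 = j ∨ 2 = k)) := by decide
  have e : ∀ a, (a = i ∨ a = j ∨ a = k) → ![α, s, t, β] a = ![α, s, t, β] j := by
    rintro a (rfl | rfl | rfl)
    exacts [hij, rfl, hjk.symm]
  rcases hc i j k with h0 | ⟨h1, h2⟩ | ⟨h1, h2⟩ | ⟨h1, h2⟩
  · exact h0
  · exact absurd ((e _ h1).trans (e _ h2).symm) h
  · exact absurd ((e _ h1).trans (e _ h2).symm) hs
  · exact absurd ((e _ h1).trans (e _ h2).symm) ht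

theorem admissible_of_ne_ne' {α β s t : X} (h : α ≠ β) (hs : α ≠ s) (ht : t ≠ β) :
    Admissible ![α, s, t, β] := by
  have := (admissible_of_ne_ne h ht hs).comp_perm (Equiv.swap 1 2)
  convert this using 1
  funext i
  fin_cases i <;> rfl

theorem admissible_of_ne {α β s t : X} (h : α ≠ β) (_ : α ≠ s) (hs' : s ≠ β) (ht : α ≠ t)
    (_ : t ≠ β) : Admissible ![α, s, t, β] := admissible_of_ne_ne h hs' ht

theorem ne_of_admissible {x y z : X} (h : Admissible ![x, x, y, z]) : x ≠ y ∧ x ≠ z := by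
  constructor
  · rintro rfl
    simpa using h 0 1 2 rfl rfl
  · rintro rfl
    simpa using h 0 1 3 rfl rfl

theorem gaugeM_mem_L4 {ρ : X → X → ℝ} (h : IsSemimetric ρ) {P : Fin 4 → X}
    (hP : Function.Injective P) : gaugeM ρ P ∈ L4 := by
  refine ⟨Real.log (edge ρ P 1) - Real.log (edge ρ P 2), Real.log (edge ρ P 2) -
    Real.log (edge ρ P 0), Real.log (edge ρ P 0) - Real.log (edge ρ P 1), by ring, ?_⟩
  funext j
  have := edge_pos h hP
  fin_cases j <;> exact ratioLog_of_pos (this _) (this _)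

theorem coe_ne_of_mem_L4 {v : Fin 3 → EReal} (hv : v ∈ L4) (j : Fin 3) : v j ≠ ⊥ ∧ v j ≠ ⊤ := by
  obtain ⟨x, y, z, -, rfl⟩ := hv
  fin_cases j <;> exact ⟨EReal.coe_ne_bot _, EReal.coe_ne_top _⟩

/-- The value is a permuted `(0, ∞, -∞)`. Even permutations rotate it; odd ones reflect and negate
it, which again gives a rotation. -/
theorem gaugeM_of_not_injective {ρ : X → X → ℝ} (h : IsSemimetric ρ) {P : Fin 4 → X}
    (hP : Admissible P) (hi : ¬ Function.Injective P) :
    gaugeM ρ P ∈ ({![0, ⊤, ⊥], ![⊥, 0, ⊤], ![⊤, ⊥, 0]} : Set (Fin 3 → EReal)) := by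
  rcases eq_of_coincidences hP with hi' | ⟨π, x, y, z, e, hy, hz⟩
  · exact absurd hi' hi
  have hQ : Admissible ![x, x, y, z] := e ▸ hP.comp_perm π
  have hPe : P = ![x, x, y, z] ∘ (π⁻¹ : Equiv.Perm (Fin 4)) := by
    rw [← e]
    funext i
    simp
  have key : ∀ j, gaugeM ρ P j = sgnSmul π⁻¹ (![0, ⊤, ⊥] (phi π⁻¹ j) : EReal) := by
    intro j
    rw [hPe, gaugeM_perm h hQ, gaugeM_degen h hy hz]
  have hphi : ∀ π : Equiv.Perm (Fin 4),
      (Equiv.Perm.sign π = 1 ∧ ((phi π 0 = 0 ∧ phi π 1 = 1 ∧ phi π 2 = 2) ∨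
        (phi π 0 = 1 ∧ phi π 1 = 2 ∧ phi π 2 = 0) ∨ (phi π 0 = 2 ∧ phi π 1 = 0 ∧ phi π 2 = 1))) ∨
      (¬ Equiv.Perm.sign π = 1 ∧ ((phi π 0 = 0 ∧ phi π 1 = 2 ∧ phi π 2 = 1) ∨
        (phi π 0 = 1 ∧ phi π 1 = 0 ∧ phi π 2 = 2) ∨ (phi π 0 = 2 ∧ phi π 1 = 1 ∧ phi π 2 = 0))) := by
    decide
  simp only [Set.mem_insert_iff, Set.mem_singleton_iff]
  rcases hphi π⁻¹ with ⟨hs, h0⟩ | ⟨hs, h0⟩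
  · have hv : gaugeM ρ P = ![![0, ⊤, ⊥] (phi π⁻¹ 0), ![0, ⊤, ⊥] (phi π⁻¹ 1),
        ![0, ⊤, ⊥] (phi π⁻¹ 2)] := by
      funext j
      rw [key j, sgnSmul, if_pos hs]
      fin_cases j <;> rfl
    rw [hv]
    rcases h0 with ⟨h0, h1, h2⟩ | ⟨h0, h1, h2⟩ | ⟨h0, h1, h2⟩ <;> rw [h0, h1, h2]
    · exact Or.inl rfl
    · exact Or.inr (Or.inr rfl)
    · exact Or.inr (Or.inl rfl)
  · have hv : gaugeM ρ P = ![-![0, ⊤, ⊥] (phi π⁻¹ 0), -![0, ⊤, ⊥] (phi π⁻¹ 1),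
        -![0, ⊤, ⊥] (phi π⁻¹ 2)] := by
      funext j
      rw [key j, sgnSmul, if_neg hs]
      fin_cases j <;> rfl
    rw [hv]
    rcases h0 with ⟨h0, h1, h2⟩ | ⟨h0, h1, h2⟩ | ⟨h0, h1, h2⟩ <;> rw [h0, h1, h2]
    · left; funext j; fin_cases j <;> simp
    · right; left; funext j; fin_cases j <;> simp
    · right; right; funext j; fin_cases j <;> simp

theorem not_mem_L4_of_mem {v : Fin 3 → EReal}
    (hv : v ∈ ({![0, ⊤, ⊥], ![⊥, 0, ⊤], ![⊤, ⊥, 0]} : Set (Fin 3 → EReal))) : v ∉ L4 := by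
  intro h
  rcases hv with rfl | rfl | rfl
  · exact (coe_ne_of_mem_L4 h 1).2 rfl
  · exact (coe_ne_of_mem_L4 h 0).1 rfl
  · exact (coe_ne_of_mem_L4 h 0).2 rfl

/-- The third component involves only distances to `α` and `β`, which cancel, and the three
components add up to zero. Infinite values arise only from coincidences among `x`, `y`, `ω`, hence
the case distinction; admissibility excludes `x = y = ω`. -/
theorem gaugeM_cocycle {ρ : X → X → ℝ} (h : IsSemimetric ρ) {x y ω α β : X}
    (hadm : Admissible ![x, y, ω, α, β]) (hαω : α ≠ ω) (hωβ : ω ≠ β) (hβα : β ≠ α)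
    (hαx : α ≠ x) (hxβ : x ≠ β) (hαy : α ≠ y) (hyβ : y ≠ β) :
    ∃ l : EReal, gaugeM ρ ![α, x, ω, β] + gaugeM ρ ![α, ω, y, β] - gaugeM ρ ![α, x, y, β] =
      ![l, -l, 0] := by
  have h1 := h.pos hαω
  have h2 := h.pos hωβ
  have h3 := h.pos hβα.symm
  have h4 := h.pos hαx
  have h5 := h.pos hxβ
  have h6 := h.pos hαy
  have h7 := h.pos hyβ
  have p1 := mul_pos h4 h2
  have p2 := mul_pos h1 h5
  have p3 := mul_pos h1 h7
  have p4 := mul_pos h6 h2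
  have p5 := mul_pos h4 h7
  have p6 := mul_pos h6 h5
  refine ⟨gaugeM ρ ![α, x, ω, β] 0 + gaugeM ρ ![α, ω, y, β] 0 - gaugeM ρ ![α, x, y, β] 0, ?_⟩
  funext j
  fin_cases j
  · rfl
  · change ratioLog (ρ α β * ρ x ω) (ρ α x * ρ ω β) + ratioLog (ρ α β * ρ ω y) (ρ α ω * ρ y β) -
      ratioLog (ρ α β * ρ x y) (ρ α x * ρ y β) =
      -(ratioLog (ρ α ω * ρ x β) (ρ α β * ρ x ω) + ratioLog (ρ α y * ρ ω β) (ρ α β * ρ ω y) -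
      ratioLog (ρ α y * ρ x β) (ρ α β * ρ x y))
    by_cases e1 : x = ω
    · subst e1
      have hxy : x ≠ y := by
        rintro rfl
        simpa using hadm 0 1 2 rfl rfl
      have q := mul_pos h3 (h.pos hxy)
      rw [h.self, mul_zero, ratioLog_zero_left, ratioLog_zero_right p2, ratioLog_of_pos q p3,
        ratioLog_of_pos p4 q]
      rfl
    by_cases e2 : ω = y
    · subst e2
      have q := mul_pos h3 (h.pos e1)
      rw [h.self, mul_zero, ratioLog_zero_left, ratioLog_zero_right p4, ratioLog_of_pos q p1,
        ratioLog_of_pos p2 q]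
      rfl
    have q1 := mul_pos h3 (h.pos e1)
    have q2 := mul_pos h3 (h.pos e2)
    by_cases e3 : x = y
    · subst e3
      rw [h.self, mul_zero, ratioLog_zero_left, ratioLog_zero_right p6, ratioLog_of_pos q1 p1,
        ratioLog_of_pos q2 p3, ratioLog_of_pos p2 q1, ratioLog_of_pos p4 q2]
      rfl
    have q3 := mul_pos h3 (h.pos e3)
    rw [ratioLog_of_pos q1 p1, ratioLog_of_pos q2 p3, ratioLog_of_pos q3 p5,
      ratioLog_of_pos p2 q1, ratioLog_of_pos p4 q2, ratioLog_of_pos p6 q3]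
    simp only [← EReal.coe_add, ← EReal.coe_sub, ← EReal.coe_neg]
    congr 1
    rw [Real.log_mul h4.ne' h2.ne', Real.log_mul h1.ne' h5.ne', Real.log_mul h1.ne' h7.ne',
      Real.log_mul h6.ne' h2.ne', Real.log_mul h4.ne' h7.ne', Real.log_mul h6.ne' h5.ne']
    ring
  · change ratioLog (ρ α x * ρ ω β) (ρ α ω * ρ x β) + ratioLog (ρ α ω * ρ y β) (ρ α y * ρ ω β) -
      ratioLog (ρ α x * ρ y β) (ρ α y * ρ x β) = 0
    rw [ratioLog_of_pos p1 p2, ratioLog_of_pos p3 p4, ratioLog_of_pos p5 p6]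
    simp only [← EReal.coe_add, ← EReal.coe_sub, ← EReal.coe_zero]
    congr 1
    rw [Real.log_mul h4.ne' h2.ne', Real.log_mul h1.ne' h5.ne', Real.log_mul h1.ne' h7.ne',
      Real.log_mul h6.ne' h2.ne', Real.log_mul h4.ne' h7.ne', Real.log_mul h6.ne' h5.ne']
    ring

end GenMobius

/-! ### Structures induced by semimetrics, and gauges -/

namespace GenMobiusStructure

universe u v

variable {X : Type u} {Y : Type v}

open Classical in
/-- The generalized Möbius structure induced by a semimetric. -/
noncomputable def ofSemimetric (ρ : X → X → ℝ) (h : IsSemimetric ρ)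
    (four : ∃ P : Fin 4 → X, Function.Injective P) : GenMobiusStructure X where
  M P := if Admissible P then gaugeM ρ P else 0
  four_points := four
  map_mem P hP := by
    rw [if_pos hP]
    by_cases hi : Function.Injective P
    · exact Or.inl (gaugeM_mem_L4 h hi)
    · exact Or.inr (gaugeM_of_not_injective h hP hi)
  map_of_not_admissible P hP := if_neg hP
  perm P hP π j := by
    rw [if_pos hP, if_pos (hP.comp_perm π), gaugeM_perm h hP]
  nondeg P hP := by
    rw [if_pos hP]
    refine ⟨fun hL => ?_, gaugeM_mem_L4 h⟩
    by_contra hi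
    exact not_mem_L4_of_mem (gaugeM_of_not_injective h hP hi) hL
  degen x y z hP := by
    rw [if_pos hP, gaugeM_degen h (ne_of_admissible hP).1 (ne_of_admissible hP).2]
  cocycle x y ω α β hadm h1 h2 h3 h4 h5 h6 h7 := by
    have hx := fun s t => admissible_of_ne (s := s) (t := t) h3.symm
    rw [if_pos (hx x ω h4 h5 h1 h2), if_pos (hx ω y h1 h2 h6 h7), if_pos (hx x y h4 h5 h6 h7)]
    exact gaugeM_cocycle h hadm h1 h2 h3 h4 h5 h6 h7

/-- `ρ` is a semimetric that induces the generalized Möbius structure `S`. -/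
structure IsGauge (S : GenMobiusStructure X) (ρ : X → X → ℝ) : Prop extends IsSemimetric ρ where
  map_eq : ∀ P, Admissible P → S.M P = gaugeM ρ P

theorem isGauge_ofSemimetric (ρ : X → X → ℝ) (h : IsSemimetric ρ)
    (four : ∃ P : Fin 4 → X, Function.Injective P) : (ofSemimetric ρ h four).IsGauge ρ :=
  ⟨h, fun _ hP => if_pos hP⟩

/-! ### Every generalized Möbius structure is induced by a semimetric -/

/-- The third logarithmic cross-ratio as a real number. -/
noncomputable def logCr (S : GenMobiusStructure X) (w x y z : X) : ℝ := (S.M ![w, x, y, z] 2).toReal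

theorem injective_of_ne {w x y z : X} (h1 : w ≠ x) (h2 : w ≠ y) (h3 : w ≠ z) (h4 : x ≠ y)
    (h5 : x ≠ z) (h6 : y ≠ z) : Function.Injective ![w, x, y, z] := by
  intro i j
  fin_cases i <;> fin_cases j <;> simp [h1, h2, h3, h4, h5, h6, h1.symm, h2.symm, h3.symm,
    h4.symm, h5.symm, h6.symm]

theorem coe_logCr (S : GenMobiusStructure X) {w x y z : X}
    (h : Function.Injective ![w, x, y, z]) : (S.logCr w x y z : EReal) = S.M ![w, x, y, z] 2 := by
  have := coe_ne_of_mem_L4 ((S.nondeg _ (.of_injective h)).2 h) 2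
  exact EReal.coe_toReal this.2 this.1

theorem logCr_swap (S : GenMobiusStructure X) {w x y z : X} (h : Admissible ![w, x, y, z]) :
    S.logCr w y x z = -S.logCr w x y z := by
  have e : ![w, x, y, z] ∘ (Equiv.swap 1 2 : Equiv.Perm (Fin 4)) = ![w, y, x, z] := by
    funext i
    fin_cases i <;> rfl
  have := S.perm _ h (Equiv.swap 1 2) 2
  rw [e, show phi (Equiv.swap 1 2) 2 = 2 by decide, sgnSmul, if_neg (by decide)] at this
  rw [logCr, this, EReal.toReal_neg_eq, logCr]

theorem logCr_klein (S : GenMobiusStructure X) {w x y z : X} (h : Admissible ![w, x, y, z]) :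
    S.logCr x w z y = S.logCr w x y z := by
  have e : ![w, x, y, z] ∘ (Equiv.swap 0 1 * Equiv.swap 2 3 : Equiv.Perm (Fin 4)) =
      ![x, w, z, y] := by
    funext i
    fin_cases i <;> rfl
  have := S.perm _ h (Equiv.swap 0 1 * Equiv.swap 2 3) 2
  rw [e, show phi (Equiv.swap 0 1 * Equiv.swap 2 3) 2 = 2 by decide, sgnSmul,
    if_pos (by decide)] at this
  rw [logCr, this, logCr]

theorem logCr_reverse (S : GenMobiusStructure X) {w x y z : X} (h : Admissible ![w, x, y, z]) :
    S.logCr z y x w = S.logCr w x y z := by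
  have e : ![w, x, y, z] ∘ (Equiv.swap 0 3 * Equiv.swap 1 2 : Equiv.Perm (Fin 4)) =
      ![z, y, x, w] := by
    funext i
    fin_cases i <;> rfl
  have := S.perm _ h (Equiv.swap 0 3 * Equiv.swap 1 2) 2
  rw [e, show phi (Equiv.swap 0 3 * Equiv.swap 1 2) 2 = 2 by decide, sgnSmul,
    if_pos (by decide)] at this
  rw [logCr, this, logCr]

/-- By `logCr_swap` the value equals its own negative. -/
theorem logCr_self (S : GenMobiusStructure X) {w x z : X} (h : Admissible ![w, x, x, z]) :
    S.logCr w x x z = 0 := by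
  have := S.logCr_swap h
  linarith

/-- The three terms are the components of one `M`-value, permuted by 3-cycles, so this is the
equation of `L4`. -/
theorem logCr_cyclic (S : GenMobiusStructure X) {w x y z : X}
    (h : Function.Injective ![w, x, y, z]) :
    S.logCr w x y z + S.logCr x y w z + S.logCr y w x z = 0 := by
  have hP := Admissible.of_injective h
  have e1 : ![w, x, y, z] ∘ (Equiv.swap 0 1 * Equiv.swap 1 2 : Equiv.Perm (Fin 4)) =
      ![x, y, w, z] := by
    funext i
    fin_cases i <;> rfl
  have e2 : ![w, x, y, z] ∘ (Equiv.swap 1 2 * Equiv.swap 0 1 : Equiv.Perm (Fin 4)) =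
      ![y, w, x, z] := by
    funext i
    fin_cases i <;> rfl
  have h1 := S.perm _ hP (Equiv.swap 0 1 * Equiv.swap 1 2) 2
  have h2 := S.perm _ hP (Equiv.swap 1 2 * Equiv.swap 0 1) 2
  rw [e1, show phi (Equiv.swap 0 1 * Equiv.swap 1 2) 2 = 1 by decide, sgnSmul,
    if_pos (by decide)] at h1
  rw [e2, show phi (Equiv.swap 1 2 * Equiv.swap 0 1) 2 = 0 by decide, sgnSmul,
    if_pos (by decide)] at h2
  obtain ⟨a, b, c, habc, hM⟩ := (S.nondeg _ hP).2 h
  rw [logCr, logCr, logCr, h1, h2, hM]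
  change c + b + a = 0
  linarith

/-- For five distinct points this is the third component of axiom (4); coincidences among `x`, `y`,
`ω` follow from `logCr_self` and `logCr_swap`. -/
theorem logCr_cocycle (S : GenMobiusStructure X) {x y ω α β : X} (h : α ≠ β) (hx : α ≠ x)
    (hx' : x ≠ β) (hy : α ≠ y) (hy' : y ≠ β) (hω : α ≠ ω) (hω' : ω ≠ β) :
    S.logCr α x ω β + S.logCr α ω y β = S.logCr α x y β := by
  by_cases h1 : x = ω
  · subst h1
    rw [S.logCr_self (admissible_of_ne h hx hx' hx hx'), zero_add]
  by_cases h2 : ω = y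
  · subst h2
    rw [S.logCr_self (admissible_of_ne h hy hy' hy hy'), add_zero]
  by_cases h3 : x = y
  · subst h3
    rw [S.logCr_self (admissible_of_ne h hx hx' hx hx'),
      S.logCr_swap (admissible_of_ne h hx hx' hω hω'), add_neg_cancel]
  have hadm : Admissible ![x, y, ω, α, β] := by
    refine .of_injective fun i j => ?_
    fin_cases i <;> fin_cases j <;> simp [h, hx, hx', hy, hy', hω, hω', h1, h2, h3, h.symm,
      hx.symm, hx'.symm, hy.symm, hy'.symm, hω.symm, hω'.symm, Ne.symm h1, Ne.symm h2, Ne.symm h3]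
  obtain ⟨l, hl⟩ := S.cocycle x y ω α β hadm hω hω' h.symm hx hx' hy hy'
  have e := congrFun hl 2
  change S.M ![α, x, ω, β] 2 + S.M ![α, ω, y, β] 2 - S.M ![α, x, y, β] 2 = 0 at e
  rw [← S.coe_logCr (injective_of_ne hx hω h h1 hx' hω'),
    ← S.coe_logCr (injective_of_ne hω hy h h2 hω' hy'),
    ← S.coe_logCr (injective_of_ne hx hy h h3 hx' hy'), ← EReal.coe_add, ← EReal.coe_sub,
    EReal.coe_eq_zero] at e
  linarith

open Classical in
/-- The logarithm of the distance in a gauge with infinitely remote point `ω`, in which `α` and `β`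
have distance one, extended by zero to `ω`. -/
noncomputable def logDist (S : GenMobiusStructure X) (ω α β x y : X) : ℝ :=
  if x = ω ∨ y = ω then 0
  -- The formula below is `log (ρ(α, x) / ρ(α, β)) + log (ρ(x, y) / ρ(x, α))`. For `x = α` both
  -- terms would be infinite, and `toReal` would replace them by zero.
  else if x = α then S.logCr α y β ω
  else S.logCr α x β ω + S.logCr x y α ω

theorem logDist_symm (S : GenMobiusStructure X) {ω α β : X} (hωα : ω ≠ α) (hαβ : α ≠ β)
    (hωβ : ω ≠ β) {x y : X} (hxy : x ≠ y) :
    S.logDist ω α β x y = S.logDist ω α β y x := by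
  by_cases h : x = ω ∨ y = ω
  · rw [logDist, logDist, if_pos h, if_pos h.symm]
  rw [logDist, logDist, if_neg h, if_neg (mt Or.symm h)]
  rw [not_or] at h
  by_cases hx : x = α
  · subst hx
    rw [if_pos rfl, if_neg hxy.symm, S.logCr_self (admissible_of_ne h.2 hxy.symm h.1 hxy.symm h.1),
      add_zero]
  by_cases hy : y = α
  · subst hy
    rw [if_pos rfl, if_neg hxy, S.logCr_self (admissible_of_ne h.1 hxy h.2 hxy h.2), add_zero]
  rw [if_neg hx, if_neg hy]
  have h1 := S.logCr_cocycle hωα.symm (Ne.symm hx) h.1 hαβ hωβ.symm (Ne.symm hy) h.2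
  have h2 := S.logCr_cyclic (injective_of_ne (Ne.symm hx) (Ne.symm hy) hωα.symm hxy h.1 h.2)
  have h3 := S.logCr_swap (admissible_of_ne h.2 hy hωα.symm hxy.symm h.1)
  linarith

theorem logDist_sub (S : GenMobiusStructure X) {ω α β : X} (hωα : ω ≠ α) (hαβ : α ≠ β)
    (hωβ : ω ≠ β) {x y z : X} (hxy : x ≠ y) (hxz : x ≠ z) (hx : x ≠ ω) (hy : y ≠ ω)
    (hz : z ≠ ω) :
    S.logDist ω α β x y - S.logDist ω α β x z = S.logCr x y z ω := by
  rw [logDist, logDist, if_neg (not_or.2 ⟨hx, hy⟩), if_neg (not_or.2 ⟨hx, hz⟩)]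
  by_cases h : x = α
  · subst h
    rw [if_pos rfl, if_pos rfl]
    have h1 := S.logCr_cocycle hx hxy hy hαβ hωβ.symm hxz hz
    linarith
  · rw [if_neg h, if_neg h]
    have h1 := S.logCr_cocycle hx hxy hy h hωα.symm hxz hz
    linarith

/-- If `ω` is one of the points, double transpositions move it to the last place, where
`logDist_sub` applies. Otherwise the cocycle relation with base points `x`, `y` splits the
cross-ratio into two that contain `ω`. -/
theorem logCr_eq_logDist (S : GenMobiusStructure X) {ω α β : X} (hωα : ω ≠ α) (hαβ : α ≠ β)
    (hωβ : ω ≠ β) {w x y z : X} (h : Function.Injective ![w, x, y, z]) :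
    S.logCr w x y z = S.logDist ω α β w x + S.logDist ω α β y z - S.logDist ω α β w y -
      S.logDist ω α β x z := by
  have hne : ∀ i j : Fin 4, i ≠ j → ![w, x, y, z] i ≠ ![w, x, y, z] j := fun i j hij => h.ne hij
  have hwx : w ≠ x := hne 0 1 (by decide)
  have hwy : w ≠ y := hne 0 2 (by decide)
  have hwz : w ≠ z := hne 0 3 (by decide)
  have hxy : x ≠ y := hne 1 2 (by decide)
  have hxz : x ≠ z := hne 1 3 (by decide)
  have hyz : y ≠ z := hne 2 3 (by decide)
  have sym := fun {x y : X} => S.logDist_symm hωα hαβ hωβ (x := x) (y := y)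
  have sub := fun {x y z : X} => S.logDist_sub hωα hαβ hωβ (x := x) (y := y) (z := z)
  have hl : ∀ t, S.logDist ω α β ω t = 0 := fun t => by rw [logDist, if_pos (Or.inl rfl)]
  have hr : ∀ t, S.logDist ω α β t ω = 0 := fun t => by rw [logDist, if_pos (Or.inr rfl)]
  have hadm := Admissible.of_injective h
  by_cases hw : w = ω
  · subst hw
    rw [hl, hl, ← S.logCr_reverse hadm, ← sub hyz.symm hxz.symm hwz.symm hwy.symm hwx.symm,
      sym hyz, sym hxz]
    ring
  by_cases hx : x = ω
  · subst hx
    have e := S.logCr_reverse (admissible_of_ne hyz hwy.symm hwz hxy.symm hxz)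
    have e' := S.logCr_klein hadm
    have e'' := logCr_reverse (S := S) (w := x) (x := w) (y := z) (z := y)
      (.of_injective (injective_of_ne hwx.symm hxz hxy hwz hwy hyz.symm))
    rw [hl, hr, ← e', ← e'', ← sub hyz hwy.symm hxy.symm hxz.symm hw, sym hwy]
    ring
  by_cases hy : y = ω
  · subst hy
    have e' := S.logCr_klein hadm
    rw [hl, hr, ← e', ← sub hwx.symm hxz hx hw hyz.symm, sym hwx]
    ring
  by_cases hz : z = ω
  · subst hz
    rw [hr, hr, ← sub hwx hwy hw hx hy]
    ring
  have h1 := sub hwx hwy hw hx hy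
  have h2 := sub hxz.symm hyz.symm hz hx hy
  have h3 := S.logCr_cocycle (α := x) (β := y) hxy hwx.symm hwy hx (Ne.symm hy) hxz hyz.symm
  have k1 := S.logCr_klein hadm
  have k2 := S.logCr_klein (admissible_of_ne hw hwx hx hwy hy)
  have k3 := S.logCr_klein (admissible_of_ne hz hxz.symm hx hyz.symm hy)
  have k4 := S.logCr_swap (admissible_of_ne hxy hxz hyz.symm hx (Ne.symm hy))
  have k5 := S.logCr_cocycle (α := x) (β := y) hxy hwx.symm hwy hxz hyz.symm hx (Ne.symm hy)
  rw [sym hyz, sym hxz]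
  linarith

/-- Even permutations act transitively on the three components, so the third one determines the
others. On degenerate quadruples both sides are forced by axioms (1) and (3). -/
theorem isGauge_of_logCr (S : GenMobiusStructure X) {ρ : X → X → ℝ} (h : IsSemimetric ρ)
    (H : ∀ P : Fin 4 → X, Function.Injective P → S.M P 2 = gaugeM ρ P 2) : S.IsGauge ρ := by
  refine ⟨h, fun P hP => ?_⟩
  funext j
  rcases eq_of_coincidences hP with hi | ⟨π, x, y, z, e, hy, hz⟩
  · have hex : ∀ j : Fin 3, ∃ π : Equiv.Perm (Fin 4), Equiv.Perm.sign π = 1 ∧ phi π 2 = j := by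
      decide
    obtain ⟨π, hs, rfl⟩ := hex j
    have h1 := S.perm P hP π 2
    have h2 := gaugeM_perm h hP π 2
    rw [sgnSmul, if_pos hs] at h1 h2
    rw [← h1, ← h2]
    exact H _ (hi.comp π.injective)
  · have hQ : Admissible ![x, x, y, z] := e ▸ hP.comp_perm π
    have hPe : P = ![x, x, y, z] ∘ (π⁻¹ : Equiv.Perm (Fin 4)) := by
      rw [← e]
      funext i
      simp
    rw [hPe, S.perm _ hQ, gaugeM_perm h hQ, gaugeM_degen h hy hz, S.degen _ _ _ hQ]

theorem exists_isGauge (S : GenMobiusStructure X) : ∃ ρ, S.IsGauge ρ := by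
  classical
  obtain ⟨Q, hQ⟩ := S.four_points
  have h01 : Q 0 ≠ Q 1 := hQ.ne (by decide)
  have h12 : Q 1 ≠ Q 2 := hQ.ne (by decide)
  have h02 : Q 0 ≠ Q 2 := hQ.ne (by decide)
  let ρ : X → X → ℝ := fun x y => if x = y then 0 else Real.exp (S.logDist (Q 0) (Q 1) (Q 2) x y)
  have hρ : ∀ {x y}, x ≠ y → ρ x y = Real.exp (S.logDist (Q 0) (Q 1) (Q 2) x y) :=
    fun h => if_neg h
  have hsemi : IsSemimetric ρ := by
    refine ⟨fun x y => ?_, fun x y => ?_, fun x y => ?_⟩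
    · by_cases h : x = y
      · rw [h]
      · rw [hρ h, hρ (Ne.symm h), S.logDist_symm h01 h12 h02 h]
    · by_cases h : x = y
      · exact (if_pos h).ge
      · rw [hρ h]
        exact (Real.exp_pos _).le
    · by_cases h : x = y
      · simp [ρ, h]
      · simp [hρ h, h]
  refine ⟨ρ, S.isGauge_of_logCr hsemi fun P hP => ?_⟩
  have eP : P = ![P 0, P 1, P 2, P 3] := by
    funext i
    fin_cases i <;> rfl
  have hpos := edge_pos hsemi hP
  have e0 : edge ρ P 0 = ρ (P 0) (P 1) * ρ (P 2) (P 3) := rfl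
  have e1 : edge ρ P 1 = ρ (P 0) (P 2) * ρ (P 1) (P 3) := rfl
  rw [gaugeM, show (2 + 1 : Fin 3) = 0 from rfl, show (2 + 2 : Fin 3) = 1 from rfl,
    ratioLog_of_pos (hpos 0) (hpos 1), e0, e1, hρ (hP.ne (by decide)), hρ (hP.ne (by decide)),
    hρ (hP.ne (by decide)), hρ (hP.ne (by decide)), ← Real.exp_add, ← Real.exp_add, Real.log_exp,
    Real.log_exp]
  rw [eP] at hP
  rw [eP, ← S.coe_logCr hP, S.logCr_eq_logDist h01 h12 h02 hP]
  congr 1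
  change _ = S.logDist (Q 0) (Q 1) (Q 2) (P 0) (P 1) + S.logDist (Q 0) (Q 1) (Q 2) (P 2) (P 3) -
    (S.logDist (Q 0) (Q 1) (Q 2) (P 0) (P 2) + S.logDist (Q 0) (Q 1) (Q 2) (P 1) (P 3))
  ring

/-- Multiplying a gauge by a function of each of the two points gives another gauge; this one
is normalized so that the distances to `u` and `v` add up to one. -/
theorem exists_isGauge_normalized (S : GenMobiusStructure X) {u v : X} (huv : u ≠ v) :
    ∃ ρ, S.IsGauge ρ ∧ ∀ x, ρ x u + ρ x v = 1 := by
  obtain ⟨ρ, h⟩ := S.exists_isGauge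
  let m : X → ℝ := fun x => ρ x u + ρ x v
  have hm : ∀ x, 0 < m x := by
    intro x
    by_cases hx : x = u
    · subst hx
      exact add_pos_of_nonneg_of_pos (h.nonneg _ _) (h.pos huv)
    · exact add_pos_of_pos_of_nonneg (h.pos hx) (h.nonneg _ _)
  -- This is the common value of `m` at `u` and `v`; putting it in the numerator gives `ρ' x u = ρ x
  -- u / m x`, and likewise for `v`.
  let k := ρ u v
  have hk : 0 < k := h.pos huv
  let ρ' : X → X → ℝ := fun x y => ρ x y * k / (m x * m y)
  have h' : IsSemimetric ρ' := by
    refine ⟨fun x y => ?_, fun x y => ?_, fun x y => ?_⟩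
    · simp only [ρ']
      rw [h.symm, mul_comm (m x)]
    · exact div_nonneg (mul_nonneg (h.nonneg _ _) hk.le) (mul_pos (hm x) (hm y)).le
    · simp only [ρ', div_eq_zero_iff, mul_eq_zero, hk.ne', (hm x).ne', (hm y).ne', or_false]
      exact h.eq_zero_iff x y
  refine ⟨ρ', ⟨h', fun P hP => ?_⟩, fun x => ?_⟩
  · rw [h.map_eq P hP]
    funext j
    have e : ∀ i, edge ρ' P i = edge ρ P i * (k * k / (m (P 0) * m (P 1) * m (P 2) * m (P 3))) := by
      intro i
      have h0 := (hm (P 0)).ne'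
      have h1 := (hm (P 1)).ne'
      have h2 := (hm (P 2)).ne'
      have h3 := (hm (P 3)).ne'
      fin_cases i <;> simp [edge, ρ'] <;> field_simp
    have hj : j + 1 ≠ j + 2 := by revert j; decide
    refine ratioLog_congr (edge_nonneg h.toIsSemimetric _ _) (edge_nonneg h' _ _)
      (edge_pos_or h.toIsSemimetric hP hj)
      (edge_pos_or h' hP hj) ?_
    rw [e, e]
    ring
  · have hu : m u = k := by simp [m, k, h.self]
    have hv : m v = k := by simp [m, k, h.self, h.symm v u]
    simp only [ρ', hu, hv]
    rw [mul_div_mul_right _ _ hk.ne', mul_div_mul_right _ _ hk.ne', ← add_div]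
    exact div_self (hm x).ne'

/-! ### The semimetrics `dA` and the Möbius topology in terms of a gauge -/

/-- `dA` is the inversion of `ρ` at `ω`, scaled so that `α` and `β` have distance one. Division in
`ℝ≥0∞` gives `∞` when exactly one of `x`, `y` is `ω`, and `0 / 0 = 0` when both are. -/
theorem IsGauge.dA_eq {S : GenMobiusStructure X} {ρ : X → X → ℝ} (h : S.IsGauge ρ) {ω α β : X}
    (hωα : ω ≠ α) (hαβ : α ≠ β) (hωβ : ω ≠ β) (x y : X) :
    S.dA ω α β x y = ENNReal.ofReal (ρ x y * (ρ α ω * ρ ω β / ρ α β)) /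
      ENNReal.ofReal (ρ x ω * ρ y ω) := by
  have h1 := h.pos hωα.symm
  have h2 := h.pos hωβ
  have h3 := h.pos hαβ
  rw [dA]
  split_ifs with hxy hb
  · rw [hxy, h.self, zero_mul, ENNReal.ofReal_zero, ENNReal.zero_div]
  · rw [h.map_eq _ (admissible_of_ne_ne hαβ hb.1 hωα.symm),
      h.map_eq _ (admissible_of_ne_ne hαβ hωβ hb.2.symm),
      h.map_eq _ (admissible_of_ne_ne hαβ hb.1 hb.2.symm)]
    change EReal.exp (ratioLog (ρ α ω * ρ x β) (ρ α β * ρ x ω) +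
      ratioLog (ρ α y * ρ ω β) (ρ α β * ρ ω y) - ratioLog (ρ α y * ρ x β) (ρ α β * ρ x y)) = _
    have h4 := h.pos hxy
    have h5 := h.pos hb.1
    have h6 := h.pos hb.2.symm
    rw [sub_eq_add_neg, EReal.exp_add, EReal.exp_add, EReal.exp_neg, exp_ratioLog, exp_ratioLog,
      exp_ratioLog, h.symm ω y]
    by_cases hx : x = ω
    · subst hx
      have h7 := h.pos (Ne.symm hxy)
      rw [h.self, mul_zero, zero_mul, ENNReal.ofReal_zero,
        ENNReal.div_zero (by simpa using mul_pos h1 h5), ENNReal.div_zero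
          (by simpa using mul_pos h4 (div_pos (mul_pos h1 h2) h3)), mul_assoc, ENNReal.top_mul]
      refine mul_ne_zero ?_ ?_
      · simpa using mul_pos h6 h2
      · exact ENNReal.inv_ne_zero.2 (ENNReal.div_ne_top ENNReal.ofReal_ne_top
          (by simpa using mul_pos h3 h4))
    by_cases hy : y = ω
    · subst hy
      rw [h.self, mul_zero, mul_zero, ENNReal.ofReal_zero,
        ENNReal.div_zero (by simpa using mul_pos h6 h2), ENNReal.div_zero
          (by simpa using mul_pos h4 (div_pos (mul_pos h1 h2) h3)), ENNReal.mul_top,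
        ENNReal.top_mul]
      · exact ENNReal.inv_ne_zero.2 (ENNReal.div_ne_top ENNReal.ofReal_ne_top
          (by simpa using mul_pos h3 h4))
      · simpa using mul_pos h1 h5
    have h7 := h.pos hx
    have h8 := h.pos hy
    rw [← ENNReal.ofReal_div_of_pos (by positivity), ← ENNReal.ofReal_div_of_pos (by positivity),
      ← ENNReal.ofReal_div_of_pos (by positivity), ← ENNReal.ofReal_div_of_pos (by positivity),
      ← ENNReal.ofReal_inv_of_pos (by positivity), ← ENNReal.ofReal_mul (by positivity),
      ← ENNReal.ofReal_mul (by positivity)]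
    congr 1
    field_simp
  · have hx : α ≠ x := by
      rintro rfl
      exact hb ⟨hαβ, Ne.symm hxy⟩
    have hy : y ≠ β := by
      rintro rfl
      exact hb ⟨hxy, hαβ.symm⟩
    rw [h.map_eq _ (admissible_of_ne_ne' hαβ hx hωβ),
      h.map_eq _ (admissible_of_ne_ne' hαβ hωα.symm hy),
      h.map_eq _ (admissible_of_ne_ne' hαβ hx hy)]
    change EReal.exp (ratioLog (ρ α β * ρ x y) (ρ α x * ρ y β) -
      ratioLog (ρ α β * ρ x ω) (ρ α x * ρ ω β) - ratioLog (ρ α β * ρ ω y) (ρ α ω * ρ y β)) = _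
    have h4 := h.pos hxy
    have h5 := h.pos hx
    have h6 := h.pos hy
    rw [sub_eq_add_neg, sub_eq_add_neg, EReal.exp_add, EReal.exp_add, EReal.exp_neg,
      EReal.exp_neg, exp_ratioLog, exp_ratioLog, exp_ratioLog, h.symm ω y]
    have hA : ∀ s t : ℝ, 0 < s → (ENNReal.ofReal s / ENNReal.ofReal t) ≠ 0 := by
      intro s t hs
      exact ENNReal.div_ne_zero.2 ⟨by simpa using hs, ENNReal.ofReal_ne_top⟩
    by_cases hx : x = ω
    · subst hx
      have h7 := h.pos (Ne.symm hxy)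
      rw [h.self, mul_zero, zero_mul, ENNReal.ofReal_zero, ENNReal.zero_div, ENNReal.inv_zero,
        ENNReal.div_zero (by simpa using mul_pos h4 (div_pos (mul_pos h1 h2) h3)),
        ENNReal.mul_top (hA _ _ (by positivity)), ENNReal.top_mul]
      exact ENNReal.inv_ne_zero.2 (ENNReal.div_ne_top ENNReal.ofReal_ne_top
          (by simpa using mul_pos h1 h6))
    by_cases hy : y = ω
    · subst hy
      rw [h.self, mul_zero, mul_zero, ENNReal.ofReal_zero, ENNReal.zero_div, ENNReal.inv_zero,
        ENNReal.div_zero (by simpa using mul_pos h4 (div_pos (mul_pos h1 h2) h3)),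
        ENNReal.mul_top]
      refine mul_ne_zero (hA _ _ (by positivity)) ?_
      exact ENNReal.inv_ne_zero.2 (ENNReal.div_ne_top ENNReal.ofReal_ne_top
          (by simpa using mul_pos h5 h2))
    have h7 := h.pos hx
    have h8 := h.pos hy
    rw [← ENNReal.ofReal_div_of_pos (by positivity), ← ENNReal.ofReal_div_of_pos (by positivity),
      ← ENNReal.ofReal_div_of_pos (by positivity), ← ENNReal.ofReal_div_of_pos (by positivity),
      ← ENNReal.ofReal_inv_of_pos (by positivity), ← ENNReal.ofReal_inv_of_pos (by positivity),
      ← ENNReal.ofReal_mul (by positivity), ← ENNReal.ofReal_mul (by positivity)]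
    congr 1
    field_simp

/-- Away from `ω`, a `dA`-ball is a sublevel set of the quotient of the distances to `y` and `ω`. -/
theorem IsGauge.dA_lt_iff {S : GenMobiusStructure X} {ρ : X → X → ℝ} (h : S.IsGauge ρ)
    {ω α β : X} (hωα : ω ≠ α) (hαβ : α ≠ β) (hωβ : ω ≠ β) {y : X} (hy : y ≠ ω) {r : ℝ}
    (hr : 0 < r) (x : X) :
    S.dA ω α β x y < ENNReal.ofReal r ↔
      ρ x y < r * (ρ y ω * ρ α β / (ρ α ω * ρ ω β)) * ρ x ω := by
  have h1 := h.pos hωα.symm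
  have h2 := h.pos hωβ
  have h3 := h.pos hαβ
  have h4 := h.pos hy
  rw [h.dA_eq hωα hαβ hωβ]
  by_cases hx : x = ω
  · subst hx
    rw [h.self, zero_mul, mul_zero, ENNReal.ofReal_zero, ENNReal.div_zero]
    · simpa using h.nonneg _ _
    · have := h.pos hy.symm
      simpa using mul_pos this (div_pos (mul_pos h1 h2) h3)
  have h5 := h.pos hx
  rw [← ENNReal.ofReal_div_of_pos (mul_pos h5 h4), ENNReal.ofReal_lt_ofReal_iff hr,
    div_lt_iff₀ (mul_pos h5 h4), ← mul_div_assoc, div_lt_iff₀ h3, mul_div_assoc',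
    div_mul_eq_mul_div, lt_div_iff₀ (mul_pos h1 h2)]
  constructor <;> intro h <;> linarith

theorem exists_two_ne (S : GenMobiusStructure X) (x y : X) :
    ∃ α β : X, α ≠ x ∧ α ≠ y ∧ β ≠ x ∧ β ≠ y ∧ α ≠ β := by
  by_cases hxy : x = y
  · subst hxy
    obtain ⟨a, b, -, h1, h2, -, h4, -⟩ := S.exists_three_ne x
    exact ⟨a, b, h1, h1, h2, h2, h4⟩
  obtain ⟨a, b, c, h1, h2, h3, h4, h5, h6⟩ := S.exists_three_ne x
  by_cases ha : a = y
  · subst ha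
    exact ⟨b, c, h2, h4.symm, h3, h6.symm, h5⟩
  by_cases hb : b = y
  · subst hb
    exact ⟨a, c, h1, ha, h3, h5.symm, h6⟩
  exact ⟨a, b, h1, ha, h2, hb, h4⟩

/-- The set described is a subbasic ball around `a` with `b` at infinity. No symmetry condition is
needed, so ratios of distances can be controlled in every generalized Möbius space. -/
theorem IsGauge.eventually_lt {S : GenMobiusStructure X} {ρ : X → X → ℝ} (h : S.IsGauge ρ)
    {p a b : X} (hab : a ≠ b) {c : ℝ} (hc : 0 < c) (hp : ρ p a < c * ρ p b) :
    ∀ᶠ t in @nhds X S.topology p, ρ t a < c * ρ t b := by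
  let := S.topology
  obtain ⟨α, β, h1, h2, h3, h4, h5⟩ := S.exists_two_ne a b
  have e1 := h.pos h2
  have e2 := h.pos h4.symm
  have e3 := h.pos h5
  have e4 := h.pos hab
  -- The radius that turns the threshold of `dA_lt_iff` into `c`.
  have hr : 0 < c * (ρ α b * ρ b β / (ρ a b * ρ α β)) := by positivity
  have key : ∀ t, S.dA b α β t a < ENNReal.ofReal (c * (ρ α b * ρ b β / (ρ a b * ρ α β))) ↔
      ρ t a < c * ρ t b := by
    intro t
    rw [h.dA_lt_iff h2.symm h5 h4.symm hab hr]
    have : c * (ρ α b * ρ b β / (ρ a b * ρ α β)) * (ρ a b * ρ α β / (ρ α b * ρ b β)) = c := by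
      field_simp
    rw [this]
  have hopen : IsOpen {t | ρ t a < c * ρ t b} := by
    refine TopologicalSpace.isOpen_generateFrom_of_mem
      ⟨b, α, β, a, _, h2.symm, h5, h4.symm, hab, hr, ?_⟩
    ext t
    exact (key t).symm
  exact hopen.mem_nhds hp

/-- Outside its zero and its pole, the quotient of the distances to two points is continuous. -/
theorem IsGauge.tendsto_div {S : GenMobiusStructure X} {ρ : X → X → ℝ} (h : S.IsGauge ρ)
    {p a b : X} (hab : a ≠ b) (ha : p ≠ a) (hb : p ≠ b) :
    Tendsto (fun t => ρ t a / ρ t b) (@nhds X S.topology p) (𝓝 (ρ p a / ρ p b)) := by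
  have e1 := h.pos ha
  have e2 := h.pos hb
  refine tendsto_order.2 ⟨fun c hc => ?_, fun c hc => ?_⟩
  -- The given bound `c` may be negative, while `eventually_lt` needs a positive constant.
  · obtain ⟨c', hc', hc2⟩ := exists_between (max_lt hc (div_pos e1 e2))
    have hc0 : 0 < c' := (le_max_right _ _).trans_lt hc'
    have hp : ρ p b < c'⁻¹ * ρ p a := by
      rw [inv_mul_eq_div, lt_div_iff₀ hc0]
      rw [lt_div_iff₀ e2] at hc2
      linarith
    have hp' : ρ p b < ((ρ p b + 1) / ρ p a) * ρ p a := by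
      rw [div_mul_cancel₀ _ e1.ne']
      linarith
    -- Any upper bound for the ratio serves: it forces `ρ t b > 0` near `p`.
    have hp2 : ρ p a < ((ρ p a + 1) / ρ p b) * ρ p b := by
      rw [div_mul_cancel₀ _ e2.ne']
      linarith
    filter_upwards [h.eventually_lt hab.symm (inv_pos.2 hc0) hp,
      h.eventually_lt hab (by positivity) hp2] with t ht ht2
    have ht0 : 0 < ρ t b := by
      refine (h.nonneg t b).lt_of_ne fun e => ?_
      rw [← e, mul_zero] at ht2
      exact absurd ht2 (h.nonneg t a).not_gt
    rw [inv_mul_eq_div, lt_div_iff₀ hc0] at ht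
    rw [lt_div_iff₀ ht0]
    have := (le_max_left c 0).trans_lt hc'
    have := mul_lt_mul_of_pos_right this ht0
    linarith
  · have hc0 : 0 < c := (div_pos e1 e2).trans hc
    have hp : ρ p a < c * ρ p b := (div_lt_iff₀ e2).1 hc
    filter_upwards [h.eventually_lt hab hc0 hp] with t ht
    have ht0 : 0 < ρ t b := by
      refine (h.nonneg t b).lt_of_ne fun e => ?_
      rw [← e, mul_zero] at ht
      exact absurd ht (h.nonneg t a).not_gt
    rwa [div_lt_iff₀ ht0]

theorem IsGauge.eventually_ne {S : GenMobiusStructure X} {ρ : X → X → ℝ} (h : S.IsGauge ρ)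
    {p a : X} (hp : p ≠ a) : ∀ᶠ t in @nhds X S.topology p, t ≠ a := by
  have := h.eventually_lt (p := p) (a := p) (b := a) hp one_pos
    (by rw [h.self, one_mul]; exact h.pos hp)
  filter_upwards [this] with t ht e
  rw [e, h.self, mul_zero] at ht
  exact absurd ht (h.nonneg a p).not_gt

/-! ### The symmetry condition in terms of a gauge -/

/-- The symmetry condition for a semimetric: if `p` is small compared with `q` and `r`, then `q` and
`r` have a quotient close to one, uniformly over all quadruples. -/
def IsBalanced (ρ : X → X → ℝ) : Prop :=
  ∀ ε > 0, ∃ δ > 0, ∀ P : Fin 4 → X, δ * max (edge ρ P 1) (edge ρ P 2) ≤ edge ρ P 0 ∨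
    |edge ρ P 1 - edge ρ P 2| ≤ ε * max (edge ρ P 1) (edge ρ P 2)

/-! ### Edge products as homogeneous coordinates of the cross-ratio triple -/

open Classical in
/-- The point of the projective plane with given coordinates, with a dummy value at the origin. -/
noncomputable def mkRP2 (w : Fin 3 → ℝ) : RP2 :=
  if h : w ≠ 0 then Projectivization.mk ℝ w h else pt011

theorem mkRP2_of_ne {w : Fin 3 → ℝ} (h : w ≠ 0) : mkRP2 w = Projectivization.mk ℝ w h :=
  dif_pos h

theorem tendsto_mkRP2 {ι : Type*} {l : Filter ι} {f : ι → Fin 3 → ℝ} {w : Fin 3 → ℝ} (hw : w ≠ 0)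
    (h : Tendsto f l (𝓝 w)) : Tendsto (fun i => mkRP2 (f i)) l (𝓝 (mkRP2 w)) := by
  have hopen : IsOpen {w : Fin 3 → ℝ | w ≠ 0} := isOpen_ne
  have hc : Continuous (fun w : {w : Fin 3 → ℝ // w ≠ 0} => mkRP2 w.1) := by
    have : (fun w : {w : Fin 3 → ℝ // w ≠ 0} => mkRP2 w.1) = Projectivization.mk' ℝ := by
      funext w
      rw [mkRP2_of_ne w.2, Projectivization.mk'_eq_mk]
    rw [this]
    exact continuous_coinduced_rng
  have hcon : ContinuousOn mkRP2 {w : Fin 3 → ℝ | w ≠ 0} := continuousOn_iff_continuous_domRestrict.2 hc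
  exact ((hcon.continuousAt (hopen.mem_nhds hw)).tendsto).comp h

theorem mkRP2_smul {w : Fin 3 → ℝ} (hw : w ≠ 0) {a : ℝ} (ha : a ≠ 0) :
    mkRP2 (a • w) = mkRP2 w := by
  rw [mkRP2_of_ne hw, mkRP2_of_ne (smul_ne_zero ha hw), Projectivization.mk_eq_mk_iff']
  exact ⟨a, rfl⟩

theorem IsGauge.crt_eq {S : GenMobiusStructure X} {ρ : X → X → ℝ} (h : S.IsGauge ρ)
    {P : Fin 4 → X} (hP : Admissible P) : S.crt P = mkRP2 (edge ρ P) := by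
  have hne : edge ρ P ≠ 0 := by
    intro e
    have := edge_pos_or h.toIsSemimetric hP (i := 0) (j := 1) (by decide)
    simp [e] at this
  have hpt : ∀ a b c h', pt a b c h' = mkRP2 ![a, b, c] := fun a b c h' => (mkRP2_of_ne h').symm
  have hbot : ∀ s t : ℝ, 0 ≤ s → ratioLog s t = ⊥ → s = 0 := by
    intro s t hs e
    rw [ratioLog, ENNReal.log_eq_bot_iff, ENNReal.div_eq_zero_iff] at e
    exact le_antisymm (by simpa using e) hs
  have hn := edge_nonneg h.toIsSemimetric P
  by_cases hi : Function.Injective P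
  · have hpos := edge_pos h.toIsSemimetric hi
    have hL4 : S.M P ∈ L4 := (S.nondeg P hP).2 hi
    have hval : ∀ j, (S.M P j).toReal = Real.log (edge ρ P (j + 1)) -
        Real.log (edge ρ P (j + 2)) := by
      intro j
      rw [h.map_eq P hP, gaugeM, ratioLog_of_pos (hpos _) (hpos _), EReal.toReal_coe]
    rw [crt, toRP2, if_neg, if_neg, if_neg, hpt, hval, hval, hval]
    -- The coordinates chosen in `toRP2` have product one, so they differ from the edge products by
    -- the geometric mean of the latter.
    · set k := Real.exp ((Real.log (edge ρ P 0) + Real.log (edge ρ P 1) +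
        Real.log (edge ρ P 2)) / 3) with hk
      have hexp : ∀ (j : Fin 3) (t : ℝ), t + (Real.log (edge ρ P 0) + Real.log (edge ρ P 1) +
          Real.log (edge ρ P 2)) / 3 = Real.log (edge ρ P j) → Real.exp t * k = edge ρ P j := by
        intro j t ht
        rw [hk, ← Real.exp_add, ht, Real.exp_log (hpos j)]
      rw [← mkRP2_smul (a := k) _ (Real.exp_ne_zero _)]
      · congr 1
        funext j
        rw [Pi.smul_apply, smul_eq_mul, mul_comm]
        fin_cases j
        · refine hexp 0 _ ?_
          change (Real.log (edge ρ P 0) - Real.log (edge ρ P 1) -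
            (Real.log (edge ρ P 2) - Real.log (edge ρ P 0))) / 3 + _ = _
          ring
        · refine hexp 1 _ ?_
          change (Real.log (edge ρ P 1) - Real.log (edge ρ P 2) -
            (Real.log (edge ρ P 0) - Real.log (edge ρ P 1))) / 3 + _ = _
          ring
        · refine hexp 2 _ ?_
          change (Real.log (edge ρ P 2) - Real.log (edge ρ P 0) -
            (Real.log (edge ρ P 1) - Real.log (edge ρ P 2))) / 3 + _ = _
          ring
      · exact fun e => Real.exp_ne_zero _ (congrFun e 0)
    · exact fun e => not_mem_L4_of_mem (Or.inr (Or.inr e)) hL4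
    · exact fun e => not_mem_L4_of_mem (Or.inr (Or.inl e)) hL4
    · exact fun e => not_mem_L4_of_mem (Or.inl e) hL4
  · have hM := gaugeM_of_not_injective h.toIsSemimetric hP hi
    have hone : ∀ j, gaugeM ρ P j = 0 → edge ρ P (j + 1) = edge ρ P (j + 2) := by
      intro j e
      have hj : ∀ j : Fin 3, j + 1 ≠ j + 2 := by decide
      have := ratioLog_inj (hn (j + 1)) (hn (j + 2)) zero_le_one zero_le_one
        (edge_pos_or h.toIsSemimetric hP (hj j)) (Or.inl one_pos) (e.trans (ratioLog_self one_pos).symm)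
      linarith
    have hfin : ∀ (j : Fin 3) (w : Fin 3 → ℝ), w ≠ 0 → edge ρ P = edge ρ P j • w →
        mkRP2 w = mkRP2 (edge ρ P) := by
      intro j w hw e
      have hj : edge ρ P j ≠ 0 := fun e0 => hne (by rw [e, e0, zero_smul])
      rw [e, mkRP2_smul hw hj]
    rw [crt, h.map_eq P hP, toRP2]
    have h01 : (![⊥, 0, ⊤] : Fin 3 → EReal) ≠ ![0, ⊤, ⊥] := fun e => by
      simpa using congrFun e 1
    have h02 : (![⊤, ⊥, 0] : Fin 3 → EReal) ≠ ![0, ⊤, ⊥] := fun e => by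
      simpa using congrFun e 1
    have h12 : (![⊤, ⊥, 0] : Fin 3 → EReal) ≠ ![⊥, 0, ⊤] := fun e => by
      simpa using congrFun e 1
    rcases hM with hM | hM | hM
    · have e0 : edge ρ P 0 = 0 := hbot _ _ (hn _) (congrFun hM 2)
      have e1 : edge ρ P 1 = edge ρ P 2 := hone 0 (congrFun hM 0)
      rw [hM, if_pos rfl, pt011, hpt]
      refine hfin 1 _ (fun e => one_ne_zero (congrFun e 1)) ?_
      funext j
      fin_cases j <;> simp [e0, e1]
    · have e0 : edge ρ P 1 = 0 := hbot _ _ (hn _) (congrFun hM 0)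
      have e1 : edge ρ P 2 = edge ρ P 0 := hone 1 (congrFun hM 1)
      rw [hM, if_neg h01, if_pos rfl, pt101, hpt]
      refine hfin 0 _ (fun e => one_ne_zero (congrFun e 0)) ?_
      funext j
      fin_cases j <;> simp [e0, e1]
    · have e0 : edge ρ P 2 = 0 := hbot _ _ (hn _) (congrFun hM 1)
      have e1 : edge ρ P 0 = edge ρ P 1 := hone 2 (congrFun hM 2)
      rw [hM, if_neg h02, if_neg h12, if_pos rfl, pt110, hpt]
      refine hfin 0 _ (fun e => one_ne_zero (congrFun e 0)) ?_
      funext j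
      fin_cases j <;> simp [e0, e1]

theorem exists_smul_of_mkRP2_eq {w w' : Fin 3 → ℝ} (hw : w ≠ 0) (hw' : w' ≠ 0)
    (h : mkRP2 w = mkRP2 w') : ∃ a : ℝ, a • w' = w := by
  rwa [mkRP2_of_ne hw, mkRP2_of_ne hw', Projectivization.mk_eq_mk_iff'] at h

/-- The line where the first coordinate vanishes meets `Deltabar` only in `(0 : 1 : 1)`. -/
theorem not_mem_Deltabar {w : Fin 3 → ℝ} (h0 : w 0 = 0) (hw : w 1 ≠ w 2) :
    mkRP2 w ∉ Deltabar := by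
  have hne : w ≠ 0 := fun e => hw (by rw [e]; rfl)
  have key : ∀ a b c h', mkRP2 w = pt a b c h' → a = 0 ∧ b ≠ c := by
    intro a b c h' e
    obtain ⟨k, hk⟩ := exists_smul_of_mkRP2_eq hne h' (e.trans (mkRP2_of_ne h').symm)
    have e0 : k * a = w 0 := congrFun hk 0
    have e1 : k * b = w 1 := congrFun hk 1
    have e2 : k * c = w 2 := congrFun hk 2
    refine ⟨?_, ?_⟩
    · rcases mul_eq_zero.1 (e0.trans h0) with hk0 | ha
      · rw [hk0, zero_mul] at e1 e2
        exact absurd (e1.symm.trans e2) hw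
      · exact ha
    · rintro rfl
      exact hw (e1.symm.trans e2)
  rintro (⟨a, b, c, h', ha, -, -, e⟩ | e | e | e)
  · exact ha.ne' (key a b c h' e).1
  · exact (key _ _ _ _ e).2 rfl
  · exact one_ne_zero (key _ _ _ _ e).1
  · exact one_ne_zero (key _ _ _ _ e).1

/-- By compactness: counterexamples for `δ = 1 / (n + 1)`, rescaled into the unit cube, accumulate
at a triple with first coordinate zero and the other two at distance at least `ε`. That point lies
in the closure of the image but not in `Deltabar`. -/
theorem IsGauge.isBalanced {S : GenMobiusStructure X} {ρ : X → X → ℝ} (h : S.IsGauge ρ)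
    (hS : S.SymmetryCondition) : IsBalanced ρ := by
  intro ε hε
  by_contra! hcon
  choose P hp hqr using fun n : ℕ => hcon (1 / ((n : ℝ) + 1)) Nat.one_div_pos_of_nat
  have hn := fun n => edge_nonneg h.toIsSemimetric (P n)
  let m : ℕ → ℝ := fun n => max (edge ρ (P n) 1) (edge ρ (P n) 2)
  have hm : ∀ n, 0 < m n := by
    intro n
    have := (hn n 0).trans_lt (hp n)
    exact pos_of_mul_pos_right this Nat.one_div_pos_of_nat.le
  -- On non-admissible quadruples all edge products vanish and the balance condition is trivial.
  have hadm : ∀ n, Admissible (P n) := by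
    intro n
    by_contra hna
    have := hm n
    simp [m, edge_eq_zero_of_not_admissible h.toIsSemimetric hna] at this
  let w : ℕ → Fin 3 → ℝ := fun n => (m n)⁻¹ • edge ρ (P n)
  have hw : ∀ n j, w n j = edge ρ (P n) j / m n := fun n j => by
    simp only [w, Pi.smul_apply, smul_eq_mul]
    rw [inv_mul_eq_div]
  have hw0 : ∀ n, w n 0 ≤ 1 / ((n : ℝ) + 1) := by
    intro n
    rw [hw, div_le_iff₀ (hm n)]
    exact (hp n).le
  have hmem : ∀ n, w n ∈ Set.Icc (0 : Fin 3 → ℝ) 1 := by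
    intro n
    refine ⟨fun j => ?_, fun j => ?_⟩
    · rw [hw]
      exact div_nonneg (hn n j) (hm n).le
    · fin_cases j
      · refine (hw0 n).trans ?_
        rw [Pi.one_apply, div_le_one (by positivity)]
        simp
      · change w n 1 ≤ 1
        rw [hw]
        exact div_le_one_of_le₀ (le_max_left _ _) (hm n).le
      · change w n 2 ≤ 1
        rw [hw]
        exact div_le_one_of_le₀ (le_max_right _ _) (hm n).le
  obtain ⟨v, -, φ, hφ, hlim⟩ := isCompact_Icc.tendsto_subseq hmem
  have hj := fun j => (tendsto_pi_nhds.1 hlim) j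
  have hv0 : v 0 = 0 := by
    refine le_antisymm (le_of_tendsto_of_tendsto (hj 0)
      (tendsto_one_div_add_atTop_nhds_zero_nat.comp hφ.tendsto_atTop)
      (.of_forall fun n => hw0 (φ n))) ?_
    exact ge_of_tendsto' (hj 0) fun n => (hmem (φ n)).1 0
  have hv12 : ε ≤ |v 1 - v 2| := by
    refine ge_of_tendsto' ((hj 1).sub (hj 2)).abs fun n => ?_
    simp only [Function.comp_apply]
    rw [hw, hw, ← sub_div, abs_div, abs_of_pos (hm (φ n)), le_div_iff₀ (hm (φ n))]
    exact (hqr (φ n)).le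
  have hne : v 1 ≠ v 2 := by
    intro e
    rw [e, sub_self, abs_zero] at hv12
    exact hε.not_ge hv12
  refine not_mem_Deltabar hv0 hne (hS ?_)
  have hv : v ≠ 0 := fun e => hne (by rw [e]; rfl)
  refine mem_closure_of_tendsto (tendsto_mkRP2 hv hlim) (.of_forall fun n => ?_)
  refine ⟨P (φ n), hadm _, ?_⟩
  rw [h.crt_eq (hadm _)]
  refine (mkRP2_smul ?_ (inv_ne_zero (hm (φ n)).ne')).symm
  intro e
  have := hm (φ n)
  simp [m, e] at this

/-! ### The uniform structure defined by a normalized gauge -/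

/-- A gauge for which the distances to `u` and `v` add up to one, and which satisfies the
symmetry condition. -/
structure IsUniformGauge (S : GenMobiusStructure X) (ρ : X → X → ℝ) (u v : X) : Prop
    extends S.IsGauge ρ where
  add_eq_one : ∀ x, ρ x u + ρ x v = 1
  balanced : IsBalanced ρ

theorem edge_vec (ρ : X → X → ℝ) (w x y z : X) : edge ρ ![w, x, y, z] =
    ![ρ w x * ρ y z, ρ w y * ρ x z, ρ w z * ρ x y] := rfl

namespace IsUniformGauge

variable {S : GenMobiusStructure X} {ρ : X → X → ℝ} {u v : X}

/-- Balance with `ε = 1 / 2`: a product is at most `δ⁻¹` times the second, or at most twice the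
third. -/
theorem ptolemy (h : S.IsUniformGauge ρ u v) : ∃ K > 0, ∀ w x y z,
    ρ w x * ρ y z ≤ K * max (ρ w y * ρ x z) (ρ w z * ρ x y) := by
  obtain ⟨δ, hδ, H⟩ := h.balanced (1 / 2) (by norm_num)
  refine ⟨max δ⁻¹ 2, by positivity, fun w x y z => ?_⟩
  have hq : 0 ≤ ρ w y * ρ x z := mul_nonneg (h.nonneg _ _) (h.nonneg _ _)
  have hr : 0 ≤ ρ w z * ρ x y := mul_nonneg (h.nonneg _ _) (h.nonneg _ _)
  have hH := H ![w, y, x, z]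
  rw [edge_vec] at hH
  change δ * max (ρ w x * ρ y z) (ρ w z * ρ y x) ≤ ρ w y * ρ x z ∨
    |ρ w x * ρ y z - ρ w z * ρ y x| ≤ 1 / 2 * max (ρ w x * ρ y z) (ρ w z * ρ y x) at hH
  rw [h.symm y x] at hH
  set p := ρ w x * ρ y z
  set q := ρ w y * ρ x z
  set r := ρ w z * ρ x y
  have hK1 := le_max_left δ⁻¹ 2
  have hK2 := le_max_right δ⁻¹ 2
  rcases hH with hH | hH
  · have h1 : δ * p ≤ q := (mul_le_mul_of_nonneg_left (le_max_left _ _) hδ.le).trans hH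
    have h2 : p ≤ δ⁻¹ * q := by rwa [inv_mul_eq_div, le_div_iff₀' hδ]
    refine h2.trans ?_
    gcongr
    exact le_max_left _ _
  · have h2 : p ≤ 2 * r := by
      rcases le_total p r with hpr | hpr
      · linarith
      · rw [max_eq_left hpr] at hH
        have := le_abs_self (p - r)
        linarith
    refine h2.trans ?_
    gcongr
    exact le_max_right _ _

theorem dist_eq_one (h : S.IsUniformGauge ρ u v) : ρ u v = 1 := by
  have := h.add_eq_one u
  rwa [h.self, zero_add] at this

theorem le_one_left (h : S.IsUniformGauge ρ u v) (x : X) : ρ x u ≤ 1 := by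
  have := h.add_eq_one x
  have := h.nonneg x v
  linarith

theorem le_one_right (h : S.IsUniformGauge ρ u v) (x : X) : ρ x v ≤ 1 := by
  have := h.add_eq_one x
  have := h.nonneg x u
  linarith

/-- A uniform gauge is a bounded quasi-metric. -/
theorem exists_bound (h : S.IsUniformGauge ρ u v) : ∃ K > 0, (∀ x y, ρ x y ≤ K) ∧
    ∀ x y z, ρ x y ≤ K * max (ρ x z) (ρ z y) := by
  obtain ⟨K, hK, H⟩ := h.ptolemy
  refine ⟨2 * K, by positivity, fun x y => ?_, fun x y z => ?_⟩
  · have := H x y u v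
    rw [h.dist_eq_one, mul_one] at this
    refine this.trans ?_
    have h1 : max (ρ x u * ρ y v) (ρ x v * ρ y u) ≤ 1 :=
      max_le (mul_le_one₀ (h.le_one_left x) (h.nonneg _ _) (h.le_one_right y))
        (mul_le_one₀ (h.le_one_right x) (h.nonneg _ _) (h.le_one_left y))
    have := mul_le_mul_of_nonneg_left h1 hK.le
    linarith
  -- Adding the cases `a = u` and `a = v` removes the factor `ρ z a`, since `ρ z u + ρ z v = 1`;
  -- this is why the constant is `2 * K`.
  · have key : ∀ a, (∀ t, ρ t a ≤ 1) → ρ x y * ρ z a ≤ K * max (ρ x z) (ρ z y) := by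
      intro a ha
      refine (H x y z a).trans ?_
      gcongr
      · exact mul_le_of_le_one_right (h.nonneg _ _) (ha y)
      · rw [h.symm y z]
        exact mul_le_of_le_one_left (h.nonneg _ _) (ha x)
    have h1 := key u h.le_one_left
    have h2 := key v h.le_one_right
    have h3 := h.add_eq_one z
    have : ρ x y = ρ x y * ρ z u + ρ x y * ρ z v := by rw [← mul_add, h3, mul_one]
    linarith

/-- Apply balance to `(x, x', a, y)`. If `ρ x x'` is small, then `ρ x a * ρ x' y` and `ρ x y * ρ x'
a` are within `ε / 4`; summing over `a = u` and `a = v` turns them into `ρ x' y` and `ρ x y`. -/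
theorem uniform_continuity (h : S.IsUniformGauge ρ u v) {ε : ℝ} (hε : 0 < ε) :
    ∃ δ > 0, ∀ x x' y, ρ x x' < δ → |ρ x y - ρ x' y| < ε := by
  obtain ⟨K, hK, hb, -⟩ := h.exists_bound
  obtain ⟨δ, hδ, H⟩ := h.balanced (ε / (4 * K)) (by positivity)
  have hδ' : 0 < ε * δ / (4 * K) := by positivity
  refine ⟨_, hδ', fun x x' y hx => ?_⟩
  have key : ∀ a, (∀ t, ρ t a ≤ 1) → |ρ x a * ρ x' y - ρ x y * ρ x' a| ≤ ε / 4 := by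
    intro a ha
    have hq : 0 ≤ ρ x a * ρ x' y := mul_nonneg (h.nonneg _ _) (h.nonneg _ _)
    have hr : 0 ≤ ρ x y * ρ x' a := mul_nonneg (h.nonneg _ _) (h.nonneg _ _)
    have hH := H ![x, x', a, y]
    rw [edge_vec] at hH
    change δ * max (ρ x a * ρ x' y) (ρ x y * ρ x' a) ≤ ρ x x' * ρ a y ∨
      |ρ x a * ρ x' y - ρ x y * ρ x' a| ≤
        ε / (4 * K) * max (ρ x a * ρ x' y) (ρ x y * ρ x' a) at hH
    rcases hH with hH | hH
    · have h1 : ρ x x' * ρ a y ≤ ε * δ / (4 * K) * K :=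
        mul_le_mul hx.le (hb _ _) (h.nonneg _ _) hδ'.le
      have h2 : ε * δ / (4 * K) * K = δ * (ε / 4) := by field_simp
      have h3 := le_of_mul_le_mul_left ((hH.trans h1).trans_eq h2) hδ
      refine le_trans ?_ h3
      rw [abs_le]
      exact ⟨by linarith [le_max_right (ρ x a * ρ x' y) (ρ x y * ρ x' a)],
        by linarith [le_max_left (ρ x a * ρ x' y) (ρ x y * ρ x' a)]⟩
    · refine hH.trans ?_
      have h1 : max (ρ x a * ρ x' y) (ρ x y * ρ x' a) ≤ K := by
        refine max_le ?_ ?_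
        · exact (mul_le_of_le_one_left (h.nonneg _ _) (ha x)).trans (hb _ _)
        · exact (mul_le_of_le_one_right (h.nonneg _ _) (ha x')).trans (hb _ _)
      have h2 : ε / (4 * K) * K = ε / 4 := by field_simp
      rw [← h2]
      gcongr
  have h1 := abs_le.1 (key u h.le_one_left)
  have h2 := abs_le.1 (key v h.le_one_right)
  have e1 : ρ x u * ρ x' y + ρ x v * ρ x' y = ρ x' y := by
    rw [← add_mul, h.add_eq_one, one_mul]
  have e2 : ρ x y * ρ x' u + ρ x y * ρ x' v = ρ x y := by
    rw [← mul_add, h.add_eq_one, mul_one]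
  rw [abs_lt]
  constructor <;> linarith [h1.1, h1.2, h2.1, h2.2]

/-! ### Limits in a uniform gauge -/

section Limits

variable {ι : Type*} {l : Filter ι}

theorem tendsto_zero_iff (h : S.IsUniformGauge ρ u v) {a b : ι → X} :
    Tendsto (fun i => ρ (a i) (b i)) l (𝓝 0) ↔ ∀ ε > 0, ∀ᶠ i in l, ρ (a i) (b i) < ε := by
  rw [Metric.tendsto_nhds]
  simp only [Real.dist_eq, sub_zero, abs_of_nonneg (h.nonneg _ _)]

theorem tendsto_symm (h : S.IsUniformGauge ρ u v) {a b : ι → X}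
    (hab : Tendsto (fun i => ρ (a i) (b i)) l (𝓝 0)) :
    Tendsto (fun i => ρ (b i) (a i)) l (𝓝 0) := by
  simpa only [h.symm] using hab

theorem tendsto_trans (h : S.IsUniformGauge ρ u v) {a b c : ι → X}
    (hab : Tendsto (fun i => ρ (a i) (b i)) l (𝓝 0))
    (hbc : Tendsto (fun i => ρ (b i) (c i)) l (𝓝 0)) :
    Tendsto (fun i => ρ (a i) (c i)) l (𝓝 0) := by
  obtain ⟨K, hK, -, H⟩ := h.exists_bound
  refine squeeze_zero (fun i => h.nonneg _ _) (fun i => H (a i) (c i) (b i)) ?_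
  simpa using (hab.max hbc).const_mul K

theorem tendsto_sub (h : S.IsUniformGauge ρ u v) {a b c d : ι → X}
    (hab : Tendsto (fun i => ρ (a i) (b i)) l (𝓝 0))
    (hcd : Tendsto (fun i => ρ (c i) (d i)) l (𝓝 0)) :
    Tendsto (fun i => ρ (a i) (c i) - ρ (b i) (d i)) l (𝓝 0) := by
  have key : ∀ {a b c : ι → X}, Tendsto (fun i => ρ (a i) (b i)) l (𝓝 0) →
      Tendsto (fun i => ρ (a i) (c i) - ρ (b i) (c i)) l (𝓝 0) := by
    intro a b c hab
    rw [Metric.tendsto_nhds]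
    intro ε hε
    obtain ⟨δ, hδ, H⟩ := h.uniform_continuity hε
    filter_upwards [h.tendsto_zero_iff.1 hab δ hδ] with i hi
    rw [Real.dist_eq, sub_zero]
    exact H _ _ _ hi
  have h1 := (key hab (c := c)).add (key hcd (c := b))
  rw [add_zero] at h1
  refine h1.congr fun i => ?_
  rw [h.symm (c i), h.symm (d i)]
  ring

theorem tendsto_of_tendsto (h : S.IsUniformGauge ρ u v) {a b : ι → X} {p q : X}
    (ha : Tendsto (fun i => ρ (a i) p) l (𝓝 0)) (hb : Tendsto (fun i => ρ (b i) q) l (𝓝 0)) :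
    Tendsto (fun i => ρ (a i) (b i)) l (𝓝 (ρ p q)) :=
  tendsto_sub_nhds_zero_iff.1 (h.tendsto_sub ha hb)

theorem tendsto_const_self (h : S.IsUniformGauge ρ u v) (a : ι → X) :
    Tendsto (fun i => ρ (a i) (a i)) l (𝓝 0) := by
  simpa only [h.self] using tendsto_const_nhds

theorem limit_unique (h : S.IsUniformGauge ρ u v) [l.NeBot] {a : ι → X} {p q : X}
    (hp : Tendsto (fun i => ρ (a i) p) l (𝓝 0)) (hq : Tendsto (fun i => ρ (a i) q) l (𝓝 0)) :
    p = q := by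
  have := tendsto_nhds_unique (h.tendsto_of_tendsto hp hq) (h.tendsto_const_self a)
  exact (h.eq_zero_iff _ _).1 this

/-- Convergence in the Möbius topology is convergence in a uniform gauge. -/
theorem tendsto_nhds_iff (h : S.IsUniformGauge ρ u v) {a : ι → X} {p : X} :
    Tendsto a l (@nhds X S.topology p) ↔ Tendsto (fun i => ρ (a i) p) l (𝓝 0) := by
  constructor
  · intro ha
    obtain ⟨K, hK, hb, -⟩ := h.exists_bound
    obtain ⟨q, -, hq, -⟩ := S.exists_two_ne p p
    refine h.tendsto_zero_iff.2 fun ε hε => ?_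
    have := h.eventually_lt hq.symm (c := ε / K) (p := p) (by positivity)
      (by rw [h.self]; exact mul_pos (by positivity) (h.pos hq.symm))
    filter_upwards [ha this] with i hi
    refine lt_of_lt_of_le hi ?_
    calc ε / K * ρ (a i) q ≤ ε / K * K := by gcongr; exact hb _ _
      _ = ε := by field_simp
  · intro ha
    refine TopologicalSpace.tendsto_nhds_generateFrom_iff.2 ?_
    rintro s ⟨ω, α, β, y, r, h1, h2, h3, hy, hr, rfl⟩ hp
    change S.dA ω α β p y < _ at hp
    change ∀ᶠ i in l, S.dA ω α β (a i) y < _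
    simp only [h.dA_lt_iff h1 h2 h3 hy hr] at hp ⊢
    exact (h.tendsto_of_tendsto ha (h.tendsto_const_self fun _ => y)).eventually_lt
      ((h.tendsto_of_tendsto ha (h.tendsto_const_self fun _ => ω)).const_mul _) hp

/-- The bound `c ≤ 1` serves non-admissible quadruples: there `M = 0` by convention while both
products vanish, so both sides must be false. -/
theorem third_lt_log_iff (h : S.IsUniformGauge ρ u v) {a b y z : X}
    {c : ℝ} (hc : 0 < c) (hc1 : c ≤ 1) : S.M ![a, b, y, z] 2 < (Real.log c : EReal) ↔
      ρ a b * ρ y z < c * (ρ a y * ρ b z) := by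
  by_cases hadm : Admissible ![a, b, y, z]
  · rw [h.map_eq _ hadm]
    change ratioLog (edge ρ _ 0) (edge ρ _ 1) < _ ↔ edge ρ ![a, b, y, z] 0 <
      c * edge ρ ![a, b, y, z] 1
    rw [← EReal.exp_lt_exp_iff, exp_ratioLog, EReal.exp_coe, Real.exp_log hc]
    rcases (edge_nonneg h.toIsSemimetric ![a, b, y, z] 1).eq_or_lt with e | e
    · have := edge_pos_or h.toIsSemimetric hadm (i := 0) (j := 1) (by decide)
      rw [← e] at this ⊢
      have h0 : 0 < edge ρ ![a, b, y, z] 0 := by simpa using this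
      rw [ENNReal.ofReal_zero, ENNReal.div_zero (by simpa using h0), mul_zero]
      simp [h0.le]
    · rw [← ENNReal.ofReal_div_of_pos e, ENNReal.ofReal_lt_ofReal_iff hc, div_lt_iff₀ e]
  · rw [S.map_of_not_admissible _ hadm]
    have h0 := edge_eq_zero_of_not_admissible h.toIsSemimetric hadm 0
    have h1 := edge_eq_zero_of_not_admissible h.toIsSemimetric hadm 1
    change ρ a b * ρ y z = 0 at h0
    change ρ a y * ρ b z = 0 at h1
    rw [h0, h1, mul_zero]
    have : Real.log c ≤ 0 := Real.log_nonpos hc.le hc1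
    have h2 : ¬ (0 : EReal) < (Real.log c : EReal) := by exact_mod_cast this.not_gt
    simpa using h2

theorem tendsto_bot_iff (h : S.IsUniformGauge ρ u v) {a b : ι → X} {y z : X} :
    Tendsto (fun i => S.M ![a i, b i, y, z] 2) l (𝓝 ⊥) ↔
      ∀ c > 0, ∀ᶠ i in l, ρ (a i) (b i) * ρ y z < c * (ρ (a i) y * ρ (b i) z) := by
  rw [EReal.tendsto_nhds_bot_iff_real]
  constructor
  · intro H c hc
    filter_upwards [H (Real.log (min c 1))] with i hi
    rw [h.third_lt_log_iff (lt_min hc one_pos) (min_le_right _ _)] at hi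
    refine hi.trans_le (mul_le_mul_of_nonneg_right (min_le_left _ _) ?_)
    exact mul_nonneg (h.nonneg _ _) (h.nonneg _ _)
  · intro H t
    filter_upwards [H (Real.exp (min t 0)) (Real.exp_pos _)] with i hi
    rw [← h.third_lt_log_iff (Real.exp_pos _) (by simp), Real.log_exp] at hi
    exact hi.trans_le (by exact_mod_cast min_le_left _ _)

theorem tendsto_zero_of_tendsto_bot (h : S.IsUniformGauge ρ u v) {a b : ι → X} {y z : X}
    (hyz : y ≠ z) (H : Tendsto (fun i => S.M ![a i, b i, y, z] 2) l (𝓝 ⊥)) :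
    Tendsto (fun i => ρ (a i) (b i)) l (𝓝 0) := by
  obtain ⟨K, hK, hb, -⟩ := h.exists_bound
  refine h.tendsto_zero_iff.2 fun ε hε => ?_
  have h1 := h.pos hyz
  filter_upwards [h.tendsto_bot_iff.1 H (ε * ρ y z / (K * K)) (by positivity)] with i hi
  have h2 : ρ (a i) y * ρ (b i) z ≤ K * K := mul_le_mul (hb _ _) (hb _ _) (h.nonneg _ _) hK.le
  have h3 : ε * ρ y z / (K * K) * (ρ (a i) y * ρ (b i) z) ≤ ε * ρ y z / (K * K) * (K * K) := by
    gcongr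
  rw [div_mul_cancel₀ _ (by positivity)] at h3
  exact lt_of_mul_lt_mul_right (hi.trans_le h3) h1.le

/-- The limits `s`, `t` are positive exactly when the pair is good, and then the denominator of the
cross-ratio stays away from zero. -/
theorem tendsto_bot_of_tendsto_zero (h : S.IsUniformGauge ρ u v) {a b : ι → X} {y z : X}
    {s t : ℝ} (hs : 0 < s) (ht : 0 < t) (H : Tendsto (fun i => ρ (a i) (b i)) l (𝓝 0))
    (ha : Tendsto (fun i => ρ (a i) y) l (𝓝 s)) (hb : Tendsto (fun i => ρ (b i) z) l (𝓝 t)) :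
    Tendsto (fun i => S.M ![a i, b i, y, z] 2) l (𝓝 ⊥) := by
  refine h.tendsto_bot_iff.2 fun c hc => ?_
  refine (H.mul_const _).eventually_lt ((ha.mul hb).const_mul c) ?_
  rw [zero_mul]
  positivity

end Limits

/-! ### Möbius convergence, Cauchy sequences and `∼` expressed by a uniform gauge -/

theorem convergesTo_iff (h : S.IsUniformGauge ρ u v) {x : ℕ → X} {p : X} :
    S.ConvergesTo x p ↔ Tendsto (fun n => ρ (x n) p) atTop (𝓝 0) := by
  constructor
  · intro H
    obtain ⟨K, hK, hb, -⟩ := h.exists_bound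
    obtain ⟨ω, α, β, h1, -, -, h4, h5, h6⟩ := S.exists_three_ne p
    have e1 := h.pos h4.symm
    have e2 := h.pos h6
    have e3 := h.pos h5
    have e4 := h.pos h1.symm
    refine h.tendsto_zero_iff.2 fun ε hε => ?_
    have hr : 0 < ε / ((ρ p ω * ρ α β / (ρ α ω * ρ ω β)) * K) := by positivity
    filter_upwards [(H ω α β h4 h5 h6 h1).eventually_lt_const (ENNReal.ofReal_pos.2 hr)] with i hi
    rw [h.dA_lt_iff h4 h5 h6 h1.symm hr] at hi
    refine hi.trans_le ?_
    calc _ ≤ ε / ((ρ p ω * ρ α β / (ρ α ω * ρ ω β)) * K) *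
          (ρ p ω * ρ α β / (ρ α ω * ρ ω β)) * K := by gcongr; exact hb _ _
      _ = ε := by field_simp
  · intro H ω α β h4 h5 h6 h1
    refine ENNReal.tendsto_nhds_zero.2 fun ε hε => ?_
    obtain ⟨r, hr, hrε⟩ := ENNReal.lt_iff_exists_real_btwn.1 hε
    have hr0 : 0 < r := by simpa using hrε.1
    have e1 := h.pos h4.symm
    have e2 := h.pos h6
    have e3 := h.pos h5
    have e4 := h.pos h1.symm
    have : ∀ᶠ n in atTop, S.dA ω α β (x n) p < ENNReal.ofReal r := by
      simp only [h.dA_lt_iff h4 h5 h6 h1.symm hr0]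
      refine H.eventually_lt
        ((h.tendsto_of_tendsto H (h.tendsto_const_self fun _ => ω)).const_mul _) ?_
      positivity
    filter_upwards [this] with n hn
    exact (hn.trans hrε.2).le

/-- Cauchy sequences with respect to a uniform gauge. -/
def _root_.GenMobiusStructure.IsCauchyFor (ρ : X → X → ℝ) (x : ℕ → X) : Prop :=
  Tendsto (fun nm : ℕ × ℕ => ρ (x nm.1) (x nm.2)) (atTop ×ˢ atTop) (𝓝 0)

theorem exists_tendsto (h : S.IsUniformGauge ρ u v) {x y : ℕ → X} (hx : IsCauchyFor ρ x)
    (hy : IsCauchyFor ρ y) : ∃ t, 0 ≤ t ∧ Tendsto (fun n => ρ (x n) (y n)) atTop (𝓝 t) := by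
  have hc : CauchySeq fun n => ρ (x n) (y n) := by
    rw [cauchySeq_iff_tendsto_dist_atTop_0, ← prod_atTop_atTop_eq]
    have := (h.tendsto_sub hx hy).abs
    rw [abs_zero] at this
    exact this
  obtain ⟨t, ht⟩ := cauchySeq_tendsto_of_complete hc
  exact ⟨t, ge_of_tendsto' ht fun n => h.nonneg _ _, ht⟩

theorem isCauchyFor_const (h : S.IsUniformGauge ρ u v) (p : X) : IsCauchyFor ρ fun _ => p :=
  h.tendsto_const_self _

theorem exists_tendsto_pos (h : S.IsUniformGauge ρ u v) {x : ℕ → X} (hx : IsCauchyFor ρ x) {p : X}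
    (hp : ¬ S.ConvergesTo x p) : ∃ t, 0 < t ∧ Tendsto (fun n => ρ (x n) p) atTop (𝓝 t) := by
  obtain ⟨t, ht, H⟩ := h.exists_tendsto hx (h.isCauchyFor_const p)
  refine ⟨t, ht.lt_of_ne ?_, H⟩
  rintro rfl
  exact hp (h.convergesTo_iff.2 H)

theorem exists_forall_ne (h : S.IsUniformGauge ρ u v) (x : ℕ → X) :
    ∃ p, ∀ q, q ≠ p → ¬ S.ConvergesTo x q := by
  by_cases H : ∃ p, S.ConvergesTo x p
  · obtain ⟨p, hp⟩ := H
    exact ⟨p, fun q hq hq' => hq (h.limit_unique (h.convergesTo_iff.1 hq') (h.convergesTo_iff.1 hp))⟩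
  · exact ⟨u, fun q _ hq => H ⟨q, hq⟩⟩

/-- Each sequence converges to at most one point, and four points leave two that avoid both limits.
Thus the quantifier over good pairs in `Equivalent` is never vacuous. -/
theorem exists_goodPair (h : S.IsUniformGauge ρ u v) (x x' : ℕ → X) :
    ∃ y z, S.GoodPair x y z ∧ S.GoodPair x' y z := by
  obtain ⟨p, hp⟩ := h.exists_forall_ne x
  obtain ⟨p', hp'⟩ := h.exists_forall_ne x'
  obtain ⟨y, z, h1, h2, h3, h4, h5⟩ := S.exists_two_ne p p'
  exact ⟨y, z, ⟨h5, hp _ h1, hp _ h3⟩, h5, hp' _ h2, hp' _ h4⟩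

/-- Boundedness of `ρ` gives one direction for any `y ≠ z`; conversely, along a Cauchy sequence the
distances to a good pair have positive limits. -/
theorem isCauchy_iff (h : S.IsUniformGauge ρ u v) {x : ℕ → X} :
    S.IsCauchy x ↔ IsCauchyFor ρ x := by
  constructor
  · rintro ⟨y, z, hg, H⟩
    exact h.tendsto_zero_of_tendsto_bot hg.1 H
  · intro H
    obtain ⟨y, z, hg, -⟩ := h.exists_goodPair x x
    obtain ⟨s, hs, hs'⟩ := h.exists_tendsto_pos H hg.2.1
    obtain ⟨t, ht, ht'⟩ := h.exists_tendsto_pos H hg.2.2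
    exact ⟨y, z, hg, h.tendsto_bot_of_tendsto_zero hs ht H (hs'.comp tendsto_fst)
      (ht'.comp tendsto_snd)⟩

theorem equivalent_iff (h : S.IsUniformGauge ρ u v) {x x' : S.CauchySequences} :
    S.Equivalent x x' ↔ Tendsto (fun n => ρ (x.1 n) (x'.1 n)) atTop (𝓝 0) := by
  constructor
  · intro H
    obtain ⟨y, z, hg, hg'⟩ := h.exists_goodPair x.1 x'.1
    exact h.tendsto_zero_of_tendsto_bot hg.1 (H y z hg hg')
  · intro H y z hg hg'
    obtain ⟨s, hs, hs'⟩ := h.exists_tendsto_pos (h.isCauchy_iff.1 x.2) hg.2.1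
    obtain ⟨t, ht, ht'⟩ := h.exists_tendsto_pos (h.isCauchy_iff.1 x'.2) hg'.2.2
    exact h.tendsto_bot_of_tendsto_zero hs ht H hs' ht'

theorem equivalence (h : S.IsUniformGauge ρ u v) : Equivalence S.Equivalent where
  refl _ := h.equivalent_iff.2 (h.tendsto_const_self _)
  symm H := h.equivalent_iff.2 (h.tendsto_symm (h.equivalent_iff.1 H))
  trans H H' := h.equivalent_iff.2 (h.tendsto_trans (h.equivalent_iff.1 H) (h.equivalent_iff.1 H'))

theorem toCompletion_eq_iff (h : S.IsUniformGauge ρ u v) {x x' : S.CauchySequences} :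
    S.toCompletion x = S.toCompletion x' ↔ Tendsto (fun n => ρ (x.1 n) (x'.1 n)) atTop (𝓝 0) := by
  rw [← h.equivalent_iff]
  exact Equivalence.quot_mk_eq_iff h.equivalence x x'

end IsUniformGauge

theorem exists_isUniformGauge (S : GenMobiusStructure X) (hS : S.SymmetryCondition) :
    ∃ ρ u v, u ≠ v ∧ S.IsUniformGauge ρ u v := by
  obtain ⟨P, hP⟩ := S.four_points
  have h01 : P 0 ≠ P 1 := hP.ne (by decide)
  obtain ⟨ρ, h, h1⟩ := S.exists_isGauge_normalized h01
  exact ⟨ρ, P 0, P 1, h01, h, h1, h.isBalanced hS⟩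

/-! ### The completion -/

/-- The limit of a gauge along two classes of Cauchy sequences. -/
noncomputable def limGauge (S : GenMobiusStructure X) (ρ : X → X → ℝ) (ξ η : S.Completion) : ℝ :=
  limUnder atTop fun n => ρ ((Quot.out ξ).1 n) ((Quot.out η).1 n)

/-- The coordinate triples allowed by the symmetry condition with parameters `ε` and `δ`. -/
def balancedSet (ε δ : ℝ) : Set (Fin 3 → ℝ) :=
  {w | δ * max (w 1) (w 2) ≤ w 0} ∪ {w | |w 1 - w 2| ≤ ε * max (w 1) (w 2)}

theorem isClosed_balancedSet (ε δ : ℝ) : IsClosed (balancedSet ε δ) :=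
  (isClosed_le (by fun_prop) (by fun_prop)).union (isClosed_le (by fun_prop) (by fun_prop))

theorem div_mem_balancedSet_iff {ε δ a : ℝ} (ha : 0 < a) {w : Fin 3 → ℝ} :
    (fun j => w j / a) ∈ balancedSet ε δ ↔ w ∈ balancedSet ε δ := by
  simp only [balancedSet, Set.mem_union, Set.mem_ofPred_eq, max_div_div_right ha.le, ← mul_div_assoc, ← sub_div,
    abs_div, abs_of_pos ha, div_le_div_iff_of_pos_right ha]

namespace IsUniformGauge

variable {S : GenMobiusStructure X} {ρ : X → X → ℝ} {u v : X}

/-- Independence of the representatives chosen by `Quot.out`: equivalent sequences have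
asymptotically equal distances by `tendsto_sub`. -/
theorem tendsto_limGauge (h : S.IsUniformGauge ρ u v) (x y : S.CauchySequences) :
    Tendsto (fun n => ρ (x.1 n) (y.1 n)) atTop
      (𝓝 (S.limGauge ρ (S.toCompletion x) (S.toCompletion y))) := by
  have key : ∀ z : S.CauchySequences,
      Tendsto (fun n => ρ (z.1 n) ((Quot.out (S.toCompletion z)).1 n)) atTop (𝓝 0) := fun z =>
    h.toCompletion_eq_iff.1 (Quot.out_eq (S.toCompletion z)).symm
  obtain ⟨t, -, ht⟩ := h.exists_tendsto (h.isCauchy_iff.1 (Quot.out (S.toCompletion x)).2)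
    (h.isCauchy_iff.1 (Quot.out (S.toCompletion y)).2)
  have := (h.tendsto_sub (key x) (key y)).add ht
  rw [zero_add] at this
  rw [limGauge, ht.limUnder_eq]
  simpa using this

theorem limGauge_incl (h : S.IsUniformGauge ρ u v) (x y : X) :
    S.limGauge ρ (S.incl x) (S.incl y) = ρ x y :=
  tendsto_nhds_unique (h.tendsto_limGauge _ _) tendsto_const_nhds

theorem isSemimetric_limGauge (h : S.IsUniformGauge ρ u v) : IsSemimetric (S.limGauge ρ) where
  symm ξ η := by
    induction ξ using Quot.ind with | _ x
    induction η using Quot.ind with | _ y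
    refine tendsto_nhds_unique (h.tendsto_limGauge x y) ?_
    exact (h.tendsto_limGauge y x).congr fun n => h.symm _ _
  nonneg ξ η := by
    induction ξ using Quot.ind with | _ x
    induction η using Quot.ind with | _ y
    exact ge_of_tendsto' (h.tendsto_limGauge x y) fun n => h.nonneg _ _
  eq_zero_iff ξ η := by
    induction ξ using Quot.ind with | _ x
    induction η using Quot.ind with | _ y
    refine Iff.trans ?_ h.toCompletion_eq_iff.symm
    refine ⟨fun e => ?_, fun H => tendsto_nhds_unique (h.tendsto_limGauge x y) H⟩
    rw [← e]
    exact h.tendsto_limGauge x y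

theorem incl_injective (h : S.IsUniformGauge ρ u v) : Function.Injective S.incl := by
  intro x y e
  rw [← h.eq_zero_iff, ← h.limGauge_incl, e, h.isSemimetric_limGauge.self]

/-- The generalized Möbius structure on the completion. -/
noncomputable def completion (h : S.IsUniformGauge ρ u v) : GenMobiusStructure S.Completion :=
  ofSemimetric (S.limGauge ρ) h.isSemimetric_limGauge
    (S.four_points.imp' (fun P => S.incl ∘ P) fun _ hP => h.incl_injective.comp hP)

theorem tendsto_edge (h : S.IsUniformGauge ρ u v) (ξ : Fin 4 → S.CauchySequences) :
    Tendsto (fun n => edge ρ fun i => (ξ i).1 n) atTop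
      (𝓝 (edge (S.limGauge ρ) fun i => S.toCompletion (ξ i))) := by
  refine tendsto_pi_nhds.2 fun j => ?_
  have := fun i j => h.tendsto_limGauge (ξ i) (ξ j)
  fin_cases j
  exacts [(this 0 1).mul (this 2 3), (this 0 2).mul (this 1 3), (this 0 3).mul (this 1 2)]

/-- Normalization and balance, with the same `δ` for each `ε`, are closed conditions and survive the
limit. -/
theorem isUniformGauge_completion (h : S.IsUniformGauge ρ u v) :
    h.completion.IsUniformGauge (S.limGauge ρ) (S.incl u) (S.incl v) where
  toIsGauge := isGauge_ofSemimetric _ _ _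
  add_eq_one ξ := by
    induction ξ using Quot.ind with | _ x
    refine tendsto_nhds_unique ((h.tendsto_limGauge x _).add (h.tendsto_limGauge x _)) ?_
    simp only [h.add_eq_one]
    exact tendsto_const_nhds
  balanced ε hε := by
    obtain ⟨δ, hδ, H⟩ := h.balanced ε hε
    refine ⟨δ, hδ, fun P => ?_⟩
    obtain ⟨ξ, rfl⟩ : ∃ ξ : Fin 4 → S.CauchySequences, (fun i => S.toCompletion (ξ i)) = P :=
      ⟨fun i => Quot.out (P i), funext fun i => Quot.out_eq _⟩
    exact (isClosed_balancedSet ε δ).mem_of_tendsto (h.tendsto_edge ξ) (.of_forall fun n => H _)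

/-- Distinct classes have positive distance, so late terms of their sequences differ: no
coincidences arise beyond those of the classes. -/
theorem eventually_admissible (h : S.IsUniformGauge ρ u v) {ξ : Fin 4 → S.CauchySequences}
    (hξ : Admissible fun i => S.toCompletion (ξ i)) :
    ∀ᶠ n in atTop, Admissible fun i => (ξ i).1 n := by
  have key : ∀ᶠ n in atTop, ∀ i j, (ξ i).1 n = (ξ j).1 n →
      S.toCompletion (ξ i) = S.toCompletion (ξ j) := by
    refine eventually_all.2 fun i => eventually_all.2 fun j => ?_
    by_cases e : S.toCompletion (ξ i) = S.toCompletion (ξ j)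
    · exact .of_forall fun _ _ => e
    · filter_upwards [(h.tendsto_limGauge (ξ i) (ξ j)).eventually_const_lt
        (h.isSemimetric_limGauge.pos e)] with n hn e'
      rw [e', h.self] at hn
      exact absurd hn (lt_irrefl _)
  filter_upwards [key] with n hn i j k hij hjk
  exact hξ i j k (hn i j hij) (hn j k hjk)

theorem isLimitStructure_completion (h : S.IsUniformGauge ρ u v) :
    S.IsLimitStructure h.completion := by
  intro ξ hξ
  rw [h.isUniformGauge_completion.crt_eq hξ]
  refine (tendsto_mkRP2 ?_ (h.tendsto_edge ξ)).congr' ?_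
  · intro e
    have := edge_pos_or h.isSemimetric_limGauge hξ (i := 0) (j := 1) (by decide)
    simp [e] at this
  · filter_upwards [h.eventually_admissible hξ] with n hn
    rw [h.crt_eq hn]

/-- Every new value is a limit of values of `S.crt`, so the closure of the image does not grow. -/
theorem symmetryCondition_completion (h : S.IsUniformGauge ρ u v) (hS : S.SymmetryCondition) :
    h.completion.SymmetryCondition := by
  refine (closure_minimal ?_ isClosed_closure).trans hS
  rintro _ ⟨P, hP, rfl⟩
  obtain ⟨ξ, rfl⟩ : ∃ ξ : Fin 4 → S.CauchySequences, (fun i => S.toCompletion (ξ i)) = P :=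
    ⟨fun i => Quot.out (P i), funext fun i => Quot.out_eq _⟩
  refine mem_closure_of_tendsto (h.isLimitStructure_completion ξ hP) ?_
  filter_upwards [h.eventually_admissible hP] with n hn
  exact ⟨_, hn, rfl⟩

theorem tendsto_incl (h : S.IsUniformGauge ρ u v) (x : S.CauchySequences) :
    Tendsto (fun n => S.limGauge ρ (S.incl (x.1 n)) (S.toCompletion x)) atTop (𝓝 0) := by
  refine h.isUniformGauge_completion.tendsto_zero_iff.2 fun ε hε => ?_
  have hx := h.tendsto_zero_iff.1 (h.isCauchy_iff.1 x.2) (ε / 2) (half_pos hε)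
  -- With `n` fixed and large, `m → ∞` in `ρ (x n) (x m) < ε / 2`.
  filter_upwards [hx.curry] with n hn
  have := le_of_tendsto (h.tendsto_limGauge ⟨fun _ => x.1 n, S.isCauchy_const (x.1 n)⟩ x)
    (hn.mono fun m hm => le_of_lt hm)
  exact this.trans_lt (half_lt_self hε)

theorem dense_range_incl (h : S.IsUniformGauge ρ u v) :
    @Dense S.Completion h.completion.topology (Set.range S.incl) := by
  let := h.completion.topology
  intro ξ
  induction ξ using Quot.ind with | _ x
  exact mem_closure_of_tendsto (h.isUniformGauge_completion.tendsto_nhds_iff.2 (h.tendsto_incl x))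
    (.of_forall fun n => ⟨_, rfl⟩)

theorem isMobiusEmbedding_incl (h : S.IsUniformGauge ρ u v) :
    S.IsMobiusEmbedding h.completion S.incl := by
  refine ⟨h.incl_injective, fun P hP => ?_⟩
  rw [h.isUniformGauge_completion.map_eq _ (hP.comp h.incl_injective), h.map_eq P hP]
  have : edge (S.limGauge ρ) (S.incl ∘ P) = edge ρ P := by
    simp only [edge, Function.comp_apply, h.limGauge_incl]
  funext j
  rw [gaugeM, gaugeM, this]

/-- Approximating the `n`-th class by a point of `X` within `1 / (n + 1)` gives a Cauchy sequence in
`X`, whose class is the limit. -/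
theorem isComplete_completion (h : S.IsUniformGauge ρ u v) : h.completion.IsComplete := by
  intro ξ hξ
  have hT := h.isUniformGauge_completion
  have hx : ∀ n : ℕ, ∃ x : X, S.limGauge ρ (S.incl x) (ξ n) < 1 / ((n : ℝ) + 1) := by
    intro n
    obtain ⟨x, hx⟩ := Quot.exists_rep (ξ n)
    obtain ⟨k, hk⟩ := (hT.tendsto_zero_iff.1 (h.tendsto_incl x) _
      (Nat.one_div_pos_of_nat (n := n))).exists
    exact ⟨x.1 k, hx ▸ hk⟩
  choose x hx using hx
  have hlim : Tendsto (fun n => S.limGauge ρ (S.incl (x n)) (ξ n)) atTop (𝓝 0) :=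
    squeeze_zero (fun n => hT.nonneg _ _) (fun n => (hx n).le)
      tendsto_one_div_add_atTop_nhds_zero_nat
  have hc : IsCauchyFor ρ x := by
    have h1 := hT.tendsto_trans (hlim.comp (tendsto_fst (g := (atTop : Filter ℕ))))
      (hT.isCauchy_iff.1 hξ)
    have h2 := hT.tendsto_trans h1 (hT.tendsto_symm (hlim.comp tendsto_snd))
    simpa only [IsCauchyFor, h.limGauge_incl, Function.comp_def] using h2
  refine ⟨S.toCompletion ⟨x, h.isCauchy_iff.2 hc⟩, hT.tendsto_nhds_iff.2 ?_⟩
  exact hT.tendsto_trans (hT.tendsto_symm hlim) (h.tendsto_incl ⟨x, h.isCauchy_iff.2 hc⟩)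

end IsUniformGauge

/-! ### Gauges and embeddings -/

theorem IsGauge.comap {S : GenMobiusStructure X} {S' : GenMobiusStructure Y} {ρ : Y → Y → ℝ}
    (h : S'.IsGauge ρ) {g : X → Y} (hg : S.IsMobiusEmbedding S' g) :
    S.IsGauge fun x y => ρ (g x) (g y) where
  symm _ _ := h.symm _ _
  nonneg _ _ := h.nonneg _ _
  eq_zero_iff _ _ := (h.eq_zero_iff _ _).trans hg.1.eq_iff
  map_eq P hP := by
    rw [← hg.2 P hP, h.map_eq _ (hP.comp hg.1)]
    rfl

theorem IsUniformGauge.comap {S : GenMobiusStructure X} {S' : GenMobiusStructure Y}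
    {ρ : Y → Y → ℝ} {g : X → Y} {u v : X} (h : S'.IsUniformGauge ρ (g u) (g v))
    (hg : S.IsMobiusEmbedding S' g) : S.IsUniformGauge (fun x y => ρ (g x) (g y)) u v where
  toIsGauge := h.toIsGauge.comap hg
  add_eq_one x := h.add_eq_one (g x)
  balanced ε hε := by
    obtain ⟨δ, hδ, H⟩ := h.balanced ε hε
    exact ⟨δ, hδ, fun P => H (g ∘ P)⟩

/-! ### Extending conditions on edge products from a dense set -/

theorem edge_eq_mul {ρ : X → X → ℝ} (hs : ∀ x y, ρ x y = ρ y x) (k : Fin 4) (j : Fin 3) :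
    ∃ m r s : Fin 4, k ≠ m ∧ k ≠ r ∧ k ≠ s ∧
      ∀ P : Fin 4 → X, edge ρ P j = ρ (P k) (P m) * ρ (P r) (P s) := by
  have hc : ∀ (k : Fin 4) (j : Fin 3), ∃ m r s : Fin 4, k ≠ m ∧ k ≠ r ∧ k ≠ s ∧
      ((((edgeVertex j 0 = k ∧ edgeVertex j 1 = m) ∨ (edgeVertex j 0 = m ∧ edgeVertex j 1 = k)) ∧
        edgeVertex j 2 = r ∧ edgeVertex j 3 = s) ∨
      (((edgeVertex j 2 = k ∧ edgeVertex j 3 = m) ∨ (edgeVertex j 2 = m ∧ edgeVertex j 3 = k)) ∧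
        edgeVertex j 0 = r ∧ edgeVertex j 1 = s)) := by decide
  obtain ⟨m, r, s, h1, h2, h3, H⟩ := hc k j
  refine ⟨m, r, s, h1, h2, h3, fun P => ?_⟩
  rw [edge_apply]
  rcases H with ⟨⟨e0, e1⟩ | ⟨e0, e1⟩, e2, e3⟩ | ⟨⟨e0, e1⟩ | ⟨e0, e1⟩, e2, e3⟩ <;>
    rw [e0, e1, e2, e3]
  · rw [hs (P m)]
  · rw [mul_comm]
  · rw [hs (P m), mul_comm]

theorem injective_update {Q : Fin 4 → X} (hQ : Function.Injective Q) {k : Fin 4} {t : X}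
    (ht : ∀ m, m ≠ k → t ≠ Q m) : Function.Injective (Function.update Q k t) := by
  intro a b hab
  by_cases ha : a = k <;> by_cases hb : b = k
  · rw [ha, hb]
  · subst ha
    rw [Function.update_self, Function.update_of_ne hb] at hab
    exact absurd hab (ht b hb)
  · subst hb
    rw [Function.update_self, Function.update_of_ne ha] at hab
    exact absurd hab.symm (ht a ha)
  · rw [Function.update_of_ne ha, Function.update_of_ne hb] at hab
    exact hQ hab

/-- A closed homogeneous condition on the products of opposite edges extends from injective
quadruples in a dense set to all injective quadruples. -/
theorem IsGauge.edge_mem_of_dense {S : GenMobiusStructure X} {ρ : X → X → ℝ} (h : S.IsGauge ρ)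
    {D : Set X} (hD : @Dense X S.topology D) {C : Set (Fin 3 → ℝ)} (hC : IsClosed C)
    (hC' : ∀ (a : ℝ), 0 < a → ∀ w : Fin 3 → ℝ, (fun j => w j / a) ∈ C ↔ w ∈ C)
    (H : ∀ Q : Fin 4 → X, Function.Injective Q → (∀ i, Q i ∈ D) → edge ρ Q ∈ C)
    (Q : Fin 4 → X) (hQ : Function.Injective Q) : edge ρ Q ∈ C := by
  let := S.topology
  -- Induction on the number `k` of leading vertices allowed to leave `D`, moving one vertex at a
  -- time.
  have key : ∀ (k : ℕ) (Q : Fin 4 → X), Function.Injective Q →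
      (∀ i : Fin 4, k ≤ i.val → Q i ∈ D) → edge ρ Q ∈ C := by
    intro k
    induction k with
    | zero => exact fun Q hQ hi => H Q hQ fun i => hi i (Nat.zero_le _)
    | succ k ih =>
      intro Q hQ hi
      by_cases hk : 4 ≤ k
      · exact ih Q hQ fun i hki => absurd (i.isLt.trans_le hk) hki.not_gt
      let κ : Fin 4 := ⟨k, not_le.1 hk⟩
      obtain ⟨b, hb⟩ : ∃ b : Fin 4, κ ≠ b := ⟨κ + 1, by generalize κ = κ; revert κ; decide⟩
      have hne : ∀ m, m ≠ κ → Q κ ≠ Q m := fun m hm => hQ.ne hm.symm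
      have hev : ∀ᶠ t in 𝓝 (Q κ), ∀ m, m ≠ κ → t ≠ Q m := by
        refine eventually_all.2 fun m => ?_
        by_cases hm : m = κ
        · exact .of_forall fun _ h => absurd hm h
        · exact (h.eventually_ne (hne m hm)).mono fun t ht _ => ht
      -- Without a symmetry condition only quotients of distances are known to be continuous. Each
      -- edge product contains the moving vertex once, so dividing by its distance to a fixed vertex
      -- suffices; homogeneity of `C` undoes the division.
      have hlim : Tendsto (fun t => fun j => edge ρ (Function.update Q κ t) j / ρ t (Q b))
          (𝓝[D] (Q κ)) (𝓝 fun j => edge ρ Q j / ρ (Q κ) (Q b)) := by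
        refine Tendsto.mono_left ?_ nhdsWithin_le_nhds
        refine tendsto_pi_nhds.2 fun j => ?_
        obtain ⟨m, r, s, h1, h2, h3, he⟩ := edge_eq_mul h.symm κ j
        have e : ∀ t, edge ρ (Function.update Q κ t) j / ρ t (Q b) =
            ρ t (Q m) / ρ t (Q b) * ρ (Q r) (Q s) := by
          intro t
          rw [he, Function.update_self, Function.update_of_ne h1.symm,
            Function.update_of_ne h2.symm, Function.update_of_ne h3.symm, mul_div_right_comm]
        have e' : edge ρ Q j / ρ (Q κ) (Q b) = ρ (Q κ) (Q m) / ρ (Q κ) (Q b) * ρ (Q r) (Q s) := by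
          rw [he, mul_div_right_comm]
        rw [e']
        simp only [e]
        refine Tendsto.mul_const _ ?_
        by_cases hmb : m = b
        · subst hmb
          rw [div_self (h.pos (hne m hb.symm)).ne']
          refine tendsto_const_nhds.congr' ?_
          filter_upwards [hev] with t ht
          rw [div_self (h.pos (ht m hb.symm)).ne']
        · exact h.tendsto_div (hQ.ne hmb) (hQ.ne h1) (hQ.ne hb)
      have : (𝓝[D] (Q κ)).NeBot := mem_closure_iff_nhdsWithin_neBot.1 (hD (Q κ))
      refine (hC' _ (h.pos (hQ.ne hb)) _).1 (hC.mem_of_tendsto hlim ?_)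
      filter_upwards [nhdsWithin_le_nhds hev, self_mem_nhdsWithin] with t ht htD
      refine (hC' _ (h.pos (ht b hb.symm)) _).2 (ih _ (injective_update hQ ht) fun i hki => ?_)
      by_cases hiκ : i = κ
      · rw [hiκ, Function.update_self]
        exact htD
      · rw [Function.update_of_ne hiκ]
        exact hi i (lt_of_le_of_ne hki fun e => hiκ (Fin.ext e.symm))
  exact key 4 Q hQ fun i hi => absurd i.isLt hi.not_gt

/-- A coincidence annihilates one product and makes the other two equal. If the first survives, it
equals the larger of the other two, and `δ ≤ 1` gives the first alternative. -/
theorem edge_mem_balancedSet_of_not_injective {ρ : X → X → ℝ} (h : IsSemimetric ρ) {ε δ : ℝ}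
    (hε : 0 < ε) (hδ : δ ≤ 1) {P : Fin 4 → X} (hP : ¬ Function.Injective P) :
    edge ρ P ∈ balancedSet ε δ := by
  have hn := edge_nonneg h P
  have h1 : ∀ p q r : ℝ, 0 ≤ q → q = r → δ * max q r ≤ p ∨ |q - r| ≤ ε * max q r := by
    rintro p q _ hq rfl
    right
    rw [sub_self, abs_zero, max_self]
    positivity
  have h2 : ∀ p q r : ℝ, 0 ≤ p → q = 0 → p = r → δ * max q r ≤ p ∨ |q - r| ≤ ε * max q r := by
    rintro p _ _ hp rfl rfl
    left
    rw [max_eq_right hp]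
    exact mul_le_of_le_one_left hp hδ
  have h3 : ∀ p q r : ℝ, 0 ≤ p → r = 0 → p = q → δ * max q r ≤ p ∨ |q - r| ≤ ε * max q r := by
    rintro p _ _ hp rfl rfl
    left
    rw [max_eq_left hp]
    exact mul_le_of_le_one_left hp hδ
  obtain ⟨i, j, hij, hne⟩ : ∃ i j, P i = P j ∧ i ≠ j := by
    simpa [Function.Injective] using hP
  have hpairs : P 0 = P 1 ∨ P 2 = P 3 ∨ P 0 = P 2 ∨ P 1 = P 3 ∨ P 0 = P 3 ∨ P 1 = P 2 := by
    have : ∀ i j : Fin 4, i ≠ j → (i = 0 ∧ j = 1 ∨ i = 2 ∧ j = 3 ∨ i = 0 ∧ j = 2 ∨ i = 1 ∧ j = 3 ∨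
        i = 0 ∧ j = 3 ∨ i = 1 ∧ j = 2) ∨ (j = 0 ∧ i = 1 ∨ j = 2 ∧ i = 3 ∨ j = 0 ∧ i = 2 ∨
        j = 1 ∧ i = 3 ∨ j = 0 ∧ i = 3 ∨ j = 1 ∧ i = 2) := by decide
    rcases this i j hne with H | H
    · refine H.imp ?_ (Or.imp ?_ (Or.imp ?_ (Or.imp ?_ (Or.imp ?_ ?_)))) <;>
      · rintro ⟨rfl, rfl⟩
        exact hij
    · refine H.imp ?_ (Or.imp ?_ (Or.imp ?_ (Or.imp ?_ (Or.imp ?_ ?_)))) <;>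
      · rintro ⟨rfl, rfl⟩
        exact hij.symm
  have sy := h.symm
  rcases hpairs with e | e | e | e | e | e
  · refine h1 _ _ _ (hn 1) ?_
    simp only [edge, e]
    exact mul_comm _ _
  · refine h1 _ _ _ (hn 1) ?_
    simp only [edge, e]
    rfl
  · refine h2 _ _ _ (hn 0) ?_ ?_
    · change ρ (P 0) (P 2) * ρ (P 1) (P 3) = 0
      rw [e, h.self, zero_mul]
    · change ρ (P 0) (P 1) * ρ (P 2) (P 3) = ρ (P 0) (P 3) * ρ (P 1) (P 2)
      rw [e, sy (P 1), mul_comm]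
  · refine h2 _ _ _ (hn 0) ?_ ?_
    · change ρ (P 0) (P 2) * ρ (P 1) (P 3) = 0
      rw [e, h.self, mul_zero]
    · change ρ (P 0) (P 1) * ρ (P 2) (P 3) = ρ (P 0) (P 3) * ρ (P 1) (P 2)
      rw [e, sy (P 2)]
  · refine h3 _ _ _ (hn 0) ?_ ?_
    · change ρ (P 0) (P 3) * ρ (P 1) (P 2) = 0
      rw [e, h.self, zero_mul]
    · change ρ (P 0) (P 1) * ρ (P 2) (P 3) = ρ (P 0) (P 2) * ρ (P 1) (P 3)
      rw [e, sy (P 3) (P 1), sy (P 2), mul_comm]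
  · refine h3 _ _ _ (hn 0) ?_ ?_
    · change ρ (P 0) (P 3) * ρ (P 1) (P 2) = 0
      rw [e, h.self, mul_zero]
    · change ρ (P 0) (P 1) * ρ (P 2) (P 3) = ρ (P 0) (P 2) * ρ (P 1) (P 3)
      rw [e]

/-- The symmetry condition passes from a dense subspace to the whole space. -/
theorem IsGauge.isBalanced_of_dense {S' : GenMobiusStructure Y}
    {ρ : Y → Y → ℝ} (h : S'.IsGauge ρ) {i : X → Y} (hd : @Dense Y S'.topology (Set.range i))
    (hb : IsBalanced fun x y => ρ (i x) (i y)) : IsBalanced ρ := by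
  intro ε hε
  obtain ⟨δ, hδ, H⟩ := hb ε hε
  refine ⟨min δ 1, lt_min hδ one_pos, fun P => ?_⟩
  change edge ρ P ∈ balancedSet ε (min δ 1)
  by_cases hP : Function.Injective P
  · refine h.edge_mem_of_dense hd (isClosed_balancedSet _ _)
      (fun a ha w => div_mem_balancedSet_iff ha) (fun Q _ hQ => ?_) P hP
    choose R hR using hQ
    obtain rfl : i ∘ R = Q := funext hR
    refine (H R).imp_left fun hle => le_trans ?_ hle
    refine mul_le_mul_of_nonneg_right (min_le_left _ _) ?_
    exact (edge_nonneg h.toIsSemimetric (i ∘ R) 1).trans (le_max_left _ _)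
  · exact edge_mem_balancedSet_of_not_injective h.toIsSemimetric hε (min_le_right _ _) hP

/-! ### Uniqueness of the completion -/

/-- Two gauges of a generalized Möbius structure induce the same cross-ratio triples in the limit. -/
theorem gaugeM_eq_of_tendsto {Z : Type*} {S : GenMobiusStructure X} {ρ ρ' : X → X → ℝ}
    (h : S.IsGauge ρ) (h' : S.IsGauge ρ') {σ : Y → Y → ℝ} {σ' : Z → Z → ℝ} (hσ : IsSemimetric σ)
    (hσ' : IsSemimetric σ') {Q : Fin 4 → Y} {Q' : Fin 4 → Z} (hQ : Admissible Q)
    (hQ' : Admissible Q') {P : ℕ → Fin 4 → X} (hP : ∀ᶠ n in atTop, Admissible (P n))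
    (hlim : Tendsto (fun n => edge ρ (P n)) atTop (𝓝 (edge σ Q)))
    (hlim' : Tendsto (fun n => edge ρ' (P n)) atTop (𝓝 (edge σ' Q'))) :
    gaugeM σ Q = gaugeM σ' Q' := by
  funext j
  have hj : ∀ j : Fin 3, j + 1 ≠ j + 2 := by decide
  refine ratioLog_congr (edge_nonneg hσ _ _) (edge_nonneg hσ' _ _) (edge_pos_or hσ hQ (hj j))
    (edge_pos_or hσ' hQ' (hj j)) ?_
  have l := fun j => tendsto_pi_nhds.1 hlim j
  have l' := fun j => tendsto_pi_nhds.1 hlim' j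
  -- The two gauges satisfy the cross-multiplied identity at every admissible `P n`, and both sides
  -- converge.
  refine tendsto_nhds_unique_of_eventuallyEq ((l (j + 1)).mul (l' (j + 2)))
    ((l' (j + 1)).mul (l (j + 2))) ?_
  filter_upwards [hP] with n hn
  refine ratioLog_inj (edge_nonneg h.toIsSemimetric _ _) (edge_nonneg h.toIsSemimetric _ _)
    (edge_nonneg h'.toIsSemimetric _ _) (edge_nonneg h'.toIsSemimetric _ _)
    (edge_pos_or h.toIsSemimetric hn (hj j)) (edge_pos_or h'.toIsSemimetric hn (hj j)) ?_
  exact congrFun ((h.map_eq _ hn).symm.trans (h'.map_eq _ hn)) j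

theorem IsUniformGauge.existsUnique_isMobiusEquiv {S : GenMobiusStructure X} {ρ : X → X → ℝ}
    {u v : X} (h : S.IsUniformGauge ρ u v) (huv : u ≠ v) (hS : S.SymmetryCondition)
    (S' : GenMobiusStructure Y) (hc : S'.IsComplete) (i : X → Y) (hi : S.IsMobiusEmbedding S' i)
    (hd : @Dense Y S'.topology (Set.range i)) :
    ∃! f : S.Completion → Y, h.completion.IsMobiusEquiv S' f ∧ i = f ∘ S.incl := by
  obtain ⟨σ, hσ, hσ1⟩ := S'.exists_isGauge_normalized (hi.1.ne huv)
  -- The symmetry condition on `X` balances the pulled-back gauge, and density of the image balances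
  -- `σ` itself.
  have hY : S'.IsUniformGauge σ (i u) (i v) :=
    ⟨hσ, hσ1, hσ.isBalanced_of_dense hd ((hσ.comap hi).isBalanced hS)⟩
  have hX := hY.comap hi
  have hT := h.isUniformGauge_completion
  have hex : ∀ x : S.CauchySequences, ∃ p, Tendsto (fun n => σ (i (x.1 n)) p) atTop (𝓝 0) := by
    intro x
    obtain ⟨p, hp⟩ := hc (fun n => i (x.1 n)) (hY.isCauchy_iff.2 (hX.isCauchy_iff.1 x.2))
    exact ⟨p, hY.tendsto_nhds_iff.1 hp⟩
  choose F hF using hex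
  let f : S.Completion → Y := fun ξ => F (Quot.out ξ)
  have hf : ∀ x, Tendsto (fun n => σ (i (x.1 n)) (f (S.toCompletion x))) atTop (𝓝 0) := by
    intro x
    refine hY.tendsto_trans ?_ (hF (Quot.out (S.toCompletion x)))
    exact hX.toCompletion_eq_iff.1 (Quot.out_eq (S.toCompletion x)).symm
  have hlim : ∀ x y, Tendsto (fun n => σ (i (x.1 n)) (i (y.1 n))) atTop
      (𝓝 (σ (f (S.toCompletion x)) (f (S.toCompletion y)))) := fun x y =>
    hY.tendsto_of_tendsto (hf x) (hf y)
  have hinj : Function.Injective f := by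
    intro ξ η e
    induction ξ using Quot.ind with | _ x
    induction η using Quot.ind with | _ y
    refine hX.toCompletion_eq_iff.2 ?_
    have := hlim x y
    rwa [show f (S.toCompletion x) = f (S.toCompletion y) from e, hY.self] at this
  have hsurj : Function.Surjective f := by
    intro y
    have hx : ∀ n : ℕ, ∃ x : X, σ (i x) y < 1 / ((n : ℝ) + 1) := by
      intro n
      let := S'.topology
      have : ∀ᶠ t in 𝓝 y, σ t y < 1 / ((n : ℝ) + 1) :=
        hY.tendsto_zero_iff.1 (hY.tendsto_nhds_iff.1 tendsto_id) _ Nat.one_div_pos_of_nat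
      obtain ⟨_, ht, x, rfl⟩ := mem_closure_iff_nhds.1 (hd y) _ this
      exact ⟨x, ht⟩
    choose x hx using hx
    have hxy : Tendsto (fun n => σ (i (x n)) y) atTop (𝓝 0) :=
      squeeze_zero (fun n => hY.nonneg _ _) (fun n => (hx n).le)
        tendsto_one_div_add_atTop_nhds_zero_nat
    have hxc : S.IsCauchy x := hX.isCauchy_iff.2 (hY.tendsto_trans
      (hxy.comp (tendsto_fst (g := (atTop : Filter ℕ))))
      (hY.tendsto_symm (hxy.comp (tendsto_snd (f := (atTop : Filter ℕ))))))
    exact ⟨S.toCompletion ⟨x, hxc⟩, hY.limit_unique (hf ⟨x, hxc⟩) hxy⟩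
  refine ⟨f, ⟨⟨⟨hinj, hsurj⟩, fun P hP => ?_⟩, ?_⟩, ?_⟩
  · obtain ⟨ξ, rfl⟩ : ∃ ξ : Fin 4 → S.CauchySequences, (fun i => S.toCompletion (ξ i)) = P :=
      ⟨fun i => Quot.out (P i), funext fun i => Quot.out_eq _⟩
    rw [hY.map_eq _ (hP.comp hinj), hT.map_eq _ hP]
    -- The pullback of `σ` and `ρ` may be different gauges of `S`; only the cross-ratios they define
    -- are compared.
    refine gaugeM_eq_of_tendsto hX.toIsGauge h.toIsGauge hY.toIsSemimetric hT.toIsSemimetric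
      (hP.comp hinj) hP (h.eventually_admissible hP) ?_ (h.tendsto_edge ξ)
    refine tendsto_pi_nhds.2 fun j => ?_
    have l := fun a b => hlim (ξ a) (ξ b)
    fin_cases j
    exacts [(l 0 1).mul (l 2 3), (l 0 2).mul (l 1 3), (l 0 3).mul (l 1 2)]
  · funext x
    exact hY.limit_unique (l := (atTop : Filter ℕ)) (hY.tendsto_const_self fun _ => i x)
      (hf ⟨fun _ => x, S.isCauchy_const x⟩)
  · rintro g ⟨⟨hg, hgp⟩, hgi⟩
    -- Pulled back along a competitor `g`, `σ` is another uniform gauge of the completion. Since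
    -- `ConvergesTo` is independent of the gauge, `g` carries limits of points of `X` to limits in
    -- `Y`, which determines it.
    have hgT : h.completion.IsUniformGauge (fun ξ η => σ (g ξ) (g η)) (S.incl u) (S.incl v) := by
      refine IsUniformGauge.comap ?_ ⟨hg.1, hgp⟩
      rw [hgi] at hY
      exact hY
    funext ξ
    induction ξ using Quot.ind with | _ x
    have := hgT.convergesTo_iff.1 (hT.convergesTo_iff.2 (h.tendsto_incl x))
    refine hY.limit_unique (this.congr fun n => ?_) (hf x)
    rw [hgi]
    rfl

end GenMobiusStructure

theorem mainTheorem2 {X : Type*} (S : GenMobiusStructure X) (hS : S.SymmetryCondition) :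
    -- the relation that defines the completion is an equivalence relation
    Equivalence S.Equivalent ∧
    -- the limits of cross-ratio triples exist, do not depend on the representatives, and define
    -- a generalized Möbius structure on the completion
    ∃ T : GenMobiusStructure S.Completion, S.IsLimitStructure T ∧
      T.SymmetryCondition ∧
      T.IsComplete ∧
      -- the canonical inclusion is a Möbius embedding with dense image
      S.IsMobiusEmbedding T S.incl ∧
      @Dense S.Completion T.topology (Set.range S.incl) ∧
      -- uniqueness of the completion
      ∀ (Y : Type*) (S' : GenMobiusStructure Y), S'.IsComplete →
        ∀ i : X → Y, S.IsMobiusEmbedding S' i → @Dense Y S'.topology (Set.range i) →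
          ∃! f : S.Completion → Y, T.IsMobiusEquiv S' f ∧ i = f ∘ S.incl := by
  obtain ⟨ρ, u, v, huv, h⟩ := S.exists_isUniformGauge hS
  exact ⟨h.equivalence, h.completion, h.isLimitStructure_completion,
    h.symmetryCondition_completion hS, h.isComplete_completion, h.isMobiusEmbedding_incl,
    h.dense_range_incl, fun Y S' hc i hi hd =>
      h.existsUnique_isMobiusEquiv huv hS S' hc i hi hd⟩
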